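/- Let $k,n$ be nonnegative integers with $n\ge k+2$. Let $\mathrm{Gr}_{k,n;1}$ be the real two-step flag variety of pairs $(U,W)$ of subspaces $U\subseteq W\subseteq\mathbb R^n$ with $\dim U=k$, $\dim W=k+2$ (equivalently, pairs $U\,\vdots\,V$ with $V=W/U$ a $2$-dimensional subspace of $\mathbb R^n/U$), with its standard topology and smooth structure. A representative of $(U,W)$ is a pair $C\,\vdots\,D$ of a $k\times n$ matrix $C$ and a $2\times n$ matrix $D$ such that $U$ is the row span of $C$ and $W$ is the row span of $C+D:=\begin{pmatrix}D\\ C\end{pmatrix}$, both matrices being of full rank. Let $\mathrm{Gr}^{>}_{k,n;1}$ (respectively $\mathrm{Gr}^{\ge}_{k,n;1}$) be the set of flags that have a representative for which all maximal minors of $C$ and of $C+D$ are positive (respectively nonnegative). Then: 1. $\mathrm{Gr}^{>}_{k,n;1}$ is a nonempty, connected, open submanifold of the smooth manifold $\mathrm{Gr}_{k,n;1}$, of full dimension $k(n-k)+2(n-k-2)$. 2. $\mathrm{Gr}^{\ge}_{k,n;1}$ is the closure of $\mathrm{Gr}^{>}_{k,n;1}$ in $\mathrm{Gr}_{k,n;1}$,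 and it is compact and connected. 3. Assume moreover that $n\ge k+4$, and let $Z$ be a real $n\times(k+4)$ matrix all of whose maximal minors are positive. Let the tree amplituhedron be the image of the nonnegative Grassmannian $\mathrm{Gr}^{\ge}_{k,n}$ (the $k$-dimensional subspaces of $\mathbb R^n$ that are the row span of a $k\times n$ matrix with nonnegative maximal minors) under $U\mapsto UZ$, and let the one-loop amplituhedron be the image of $\mathrm{Gr}^{\ge}_{k,n;1}$ under $(U,W)\mapsto(UZ,WZ)$; in terms of representatives these maps are $C\mapsto CZ$ and $C\,\vdots\,D\mapsto CZ\,\vdots\,DZ$. Then all these images have the full dimensions, so that the tree amplituhedron is a subset of $\mathrm{Gr}_{k,k+4}$ and the one-loop amplituhedron is a subset of $\mathrm{Gr}_{k,k+4;1}$, and both are nonempty, compact and connected. -/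

import Mathlib

open scoped Manifold ContDiff Matrix

noncomputable section

namespace Loopy

/-! ### Matrices, minors and row spans -/

/-- All maximal minors of an `r × n` matrix (one for each `r`-element set of columns, listed in
increasing order) are nonnegative. -/
def MinorsNonneg {r n : ℕ} (M : Matrix (Fin r) (Fin n) ℝ) : Prop :=
  ∀ I : Fin r ↪o Fin n, 0 ≤ (M.submatrix id I).det

/-- All maximal minors of an `r × n` matrix are positive. -/
def MinorsPos {r n : ℕ} (M : Matrix (Fin r) (Fin n) ℝ) : Prop :=
  ∀ I : Fin r ↪o Fin n, 0 < (M.submatrix id I).det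

/-- All maximal minors of an `n × r` matrix (one for each `r`-element set of rows) are positive. -/
def TallMinorsPos {r n : ℕ} (Z : Matrix (Fin n) (Fin r) ℝ) : Prop :=
  ∀ I : Fin r ↪o Fin n, 0 < (Z.submatrix I id).det

/-- The row span of a matrix. -/
def rowSpan {ι : Type*} {n : ℕ} (M : Matrix ι (Fin n) ℝ) : Submodule ℝ (Fin n → ℝ) :=
  Submodule.span ℝ (Set.range M.row)

/-- The matrix `C + D` of a loopy pair `C ⋮ D`: the two rows of `D` on top of the `k` rows
of `C`. -/
def stack {k n : ℕ} (C : Matrix (Fin k) (Fin n) ℝ) (D : Matrix (Fin 2) (Fin n) ℝ) :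
    Matrix (Fin (2 + k)) (Fin n) ℝ :=
  Matrix.of (Fin.append D C)

theorem mem_rowSpan {ι : Type*} [Fintype ι] {n : ℕ} {M : Matrix ι (Fin n) ℝ} {v : Fin n → ℝ} :
    v ∈ rowSpan M ↔ ∃ c : ι → ℝ, c ᵥ* M = v := by
  rw [rowSpan, ← range_vecMulLinear]
  rfl

theorem rowSpan_le_iff {ι κ : Type*} [Fintype ι] {n : ℕ}
    {M : Matrix ι (Fin n) ℝ} {M' : Matrix κ (Fin n) ℝ} :
    rowSpan M' ≤ rowSpan M ↔ ∃ N : Matrix κ ι ℝ, M' = N * M := by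
  constructor
  · intro h
    have h1 : ∀ i, ∃ c : ι → ℝ, c ᵥ* M = M' i := fun i =>
      mem_rowSpan.1 (h (Submodule.subset_span ⟨i, rfl⟩))
    choose N hN using h1
    refine ⟨Matrix.of N, ?_⟩
    ext i j
    rw [← hN i]
    rfl
  · rintro ⟨N, rfl⟩
    refine Submodule.span_le.2 ?_
    rintro _ ⟨i, rfl⟩
    exact mem_rowSpan.2 ⟨N i, rfl⟩

theorem rank_eq_finrank_rowSpan {ι : Type*} [Finite ι] {n : ℕ} (M : Matrix ι (Fin n) ℝ) :
    M.rank = Module.finrank ℝ (rowSpan M) :=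
  Matrix.rank_eq_finrank_span_row M

theorem rowSpan_stack {k n : ℕ} (C : Matrix (Fin k) (Fin n) ℝ) (D : Matrix (Fin 2) (Fin n) ℝ) :
    rowSpan (stack C D) = rowSpan C ⊔ rowSpan D := by
  rw [rowSpan, rowSpan, rowSpan, ← Submodule.span_union]
  congr 1
  ext v
  simp only [Set.mem_range, Set.mem_union]
  constructor
  · rintro ⟨i, rfl⟩
    refine Fin.addCases (fun j => ?_) (fun j => ?_) i
    · exact Or.inr ⟨j, (Fin.append_left D C j).symm⟩
    · exact Or.inl ⟨j, (Fin.append_right D C j).symm⟩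
  · rintro (⟨j, rfl⟩ | ⟨j, rfl⟩)
    · exact ⟨Fin.natAdd 2 j, Fin.append_right D C j⟩
    · exact ⟨Fin.castAdd k j, Fin.append_left D C j⟩

theorem map_rowSpan {ι : Type*} {n m : ℕ} (M : Matrix ι (Fin n) ℝ) (Z : Matrix (Fin n) (Fin m) ℝ) :
    (rowSpan M).map Z.vecMulLinear = rowSpan (M * Z) := by
  rw [rowSpan, rowSpan, Submodule.map_span, ← Set.range_comp]
  rfl

/-! ### The Grassmannian -/

/-- The real Grassmannian of `k`-dimensional subspaces of `ℝⁿ`. -/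
def Gr (k n : ℕ) : Type := {U : Submodule ℝ (Fin n → ℝ) // Module.finrank ℝ U = k}

/-- The subspace underlying a point of the Grassmannian. -/
def Gr.toSubmodule {k n : ℕ} (U : Gr k n) : Submodule ℝ (Fin n → ℝ) := U.1

/-- Full rank `k × n` matrices. -/
abbrev FullRankMat (k n : ℕ) : Type := {C : Matrix (Fin k) (Fin n) ℝ // C.rank = k}

/-- The row span map from full rank matrices to the Grassmannian. -/
def Gr.proj {k n : ℕ} (C : FullRankMat k n) : Gr k n :=
  ⟨rowSpan C.1, by rw [← rank_eq_finrank_rowSpan, C.2]⟩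

/-- The topology of the Grassmannian is the quotient topology from full rank matrices. -/
instance (k n : ℕ) : TopologicalSpace (Gr k n) := TopologicalSpace.coinduced Gr.proj inferInstance

/-- The nonnegative Grassmannian: subspaces with a full rank representative all of whose maximal
minors are nonnegative. -/
def nonnegGr (k n : ℕ) : Set (Gr k n) := {U | ∃ C : FullRankMat k n, MinorsNonneg C.1 ∧ Gr.proj C = U}

/-! ### The two-step flag variety, i.e. the one-loop Grassmannian -/

/-- The two-step flag variety `{(U, W) | U ⊆ W ⊆ ℝⁿ, dim U = k, dim W = k + 2}`. A loopy vector
space `U ⋮ V` with `V` a two-dimensional subspace of `ℝⁿ / U` is the flag `(U, W)` where `W = U + V`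
is the preimage of `V` in `ℝⁿ`. -/
@[ext]
structure Flag (k n : ℕ) : Type where
  U : Submodule ℝ (Fin n → ℝ)
  W : Submodule ℝ (Fin n → ℝ)
  finrank_U : Module.finrank ℝ U = k
  finrank_W : Module.finrank ℝ W = k + 2
  le : U ≤ W

/-- Full rank loopy pairs `C ⋮ D`: both `C` and `C + D` have full rank. -/
abbrev FullRankPair (k n : ℕ) : Type :=
  {P : Matrix (Fin k) (Fin n) ℝ × Matrix (Fin 2) (Fin n) ℝ //
    P.1.rank = k ∧ (stack P.1 P.2).rank = k + 2}

/-- The flag represented by a full rank loopy pair. -/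
def Flag.proj {k n : ℕ} (P : FullRankPair k n) : Flag k n where
  U := rowSpan P.1.1
  W := rowSpan P.1.1 ⊔ rowSpan P.1.2
  finrank_U := by rw [← rank_eq_finrank_rowSpan, P.2.1]
  finrank_W := by rw [← rowSpan_stack, ← rank_eq_finrank_rowSpan, P.2.2]
  le := le_sup_left

/-- The topology of the flag variety is the quotient topology from full rank loopy pairs. -/
instance (k n : ℕ) : TopologicalSpace (Flag k n) :=
  TopologicalSpace.coinduced Flag.proj inferInstance

/-- The positive part: flags with a representative `C ⋮ D` such that all maximal minors of `C` and
of `C + D` are positive. -/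
def posFlag (k n : ℕ) : Set (Flag k n) :=
  {F | ∃ P : FullRankPair k n, MinorsPos P.1.1 ∧ MinorsPos (stack P.1.1 P.1.2) ∧ Flag.proj P = F}

/-- The nonnegative part: flags with a full rank representative `C ⋮ D` such that all maximal minors
of `C` and of `C + D` are nonnegative. -/
def nonnegFlag (k n : ℕ) : Set (Flag k n) :=
  {F | ∃ P : FullRankPair k n,
    MinorsNonneg P.1.1 ∧ MinorsNonneg (stack P.1.1 P.1.2) ∧ Flag.proj P = F}

/-! ### The tree and one-loop amplituhedra -/

/-- The pair of subspaces underlying a flag. -/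
def Flag.toPair {k n : ℕ} (F : Flag k n) :
    Submodule ℝ (Fin n → ℝ) × Submodule ℝ (Fin n → ℝ) := (F.U, F.W)

/-- The tree amplituhedron: the image of the nonnegative Grassmannian under `U ↦ U Z`, as a set of
subspaces of `ℝ^(k+4)` whose dimension is not prescribed. -/
def treeAmplituhedron {k n : ℕ} (Z : Matrix (Fin n) (Fin (k + 4)) ℝ) :
    Set (Submodule ℝ (Fin (k + 4) → ℝ)) :=
  (fun U : Gr k n => U.toSubmodule.map Z.vecMulLinear) '' nonnegGr k n

/-- The one-loop amplituhedron: the image of the nonnegative part of the flag variety under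
`(U, W) ↦ (U Z, W Z)`, as a set of pairs of subspaces of `ℝ^(k+4)` whose dimensions are not
prescribed. -/
def loopAmplituhedron {k n : ℕ} (Z : Matrix (Fin n) (Fin (k + 4)) ℝ) :
    Set (Submodule ℝ (Fin (k + 4) → ℝ) × Submodule ℝ (Fin (k + 4) → ℝ)) :=
  (fun F : Flag k n => (F.U.map Z.vecMulLinear, F.W.map Z.vecMulLinear)) '' nonnegFlag k n

/-- In terms of representatives the tree amplituhedron map is `C ↦ C Z`. -/
theorem map_proj_tree {k n m : ℕ} (C : FullRankMat k n) (Z : Matrix (Fin n) (Fin m) ℝ) :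
    (Gr.proj C).toSubmodule.map Z.vecMulLinear = rowSpan (C.1 * Z) := map_rowSpan _ _

/-- In terms of representatives the one-loop amplituhedron map is `C ⋮ D ↦ C Z ⋮ D Z`. -/
theorem map_proj_loop {k n m : ℕ} (P : FullRankPair k n) (Z : Matrix (Fin n) (Fin m) ℝ) :
    (Flag.proj P).U.map Z.vecMulLinear = rowSpan (P.1.1 * Z) ∧
    (Flag.proj P).W.map Z.vecMulLinear = rowSpan (P.1.1 * Z) ⊔ rowSpan (P.1.2 * Z) := by
  refine ⟨map_rowSpan _ _, ?_⟩
  simp only [Flag.proj, Submodule.map_sup, map_rowSpan]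

/-! ### The smooth structure of the flag variety

For an invertible matrix `g` with rows indexed by `Fin k ⊕ (Fin 2 ⊕ Fin (n - k - 2))` there is the
affine chart whose inverse sends a `k × (n - k)` matrix `X` and a `2 × (n - k - 2)` matrix `Y` to the
flag represented by the loopy pair `(1 | X) g ⋮ (0 | 1 | Y) g`. -/

/-- An ordered basis of `ℝⁿ`, split in blocks of sizes `k`, `2`, `n - k - 2`: the invertible matrix
of its vectors together with the inverse matrix. -/
structure Frame (k n : ℕ) : Type where
  mat : Matrix (Fin k ⊕ (Fin 2 ⊕ Fin (n - k - 2))) (Fin n) ℝ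
  inv : Matrix (Fin n) (Fin k ⊕ (Fin 2 ⊕ Fin (n - k - 2))) ℝ
  mat_mul_inv : mat * inv = 1
  inv_mul_mat : inv * mat = 1

/-- The dimension of the flag variety. -/
abbrev flagDim (k n : ℕ) : ℕ := k * (n - k) + 2 * (n - k - 2)

/-- A numbering of the entries of the two coordinate matrices. -/
def coordEquiv {k n : ℕ} (h : k + 2 ≤ n) :
    (Fin k × (Fin 2 ⊕ Fin (n - k - 2))) ⊕ (Fin 2 × Fin (n - k - 2)) ≃ Fin (flagDim k n) :=
  Fintype.equivFinOfCardEq (by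
    have : 2 + (n - k - 2) = n - k := by omega
    simp [this])

abbrev Coord (k n : ℕ) : Type := EuclideanSpace ℝ (Fin (flagDim k n))

/-- The coordinate matrix `X`. -/
def coordX {k n : ℕ} (h : k + 2 ≤ n) (x : Coord k n) :
    Matrix (Fin k) (Fin 2 ⊕ Fin (n - k - 2)) ℝ :=
  Matrix.of fun i j => x (coordEquiv h (Sum.inl (i, j)))

/-- The coordinate matrix `Y`. -/
def coordY {k n : ℕ} (h : k + 2 ≤ n) (x : Coord k n) : Matrix (Fin 2) (Fin (n - k - 2)) ℝ :=
  Matrix.of fun i j => x (coordEquiv h (Sum.inr (i, j)))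

/-- The coordinate vector with given coordinate matrices. -/
def coordMk {k n : ℕ} (h : k + 2 ≤ n) (X : Matrix (Fin k) (Fin 2 ⊕ Fin (n - k - 2)) ℝ)
    (Y : Matrix (Fin 2) (Fin (n - k - 2)) ℝ) : Coord k n :=
  WithLp.toLp 2 fun a =>
    Sum.elim (fun p => X p.1 p.2) (fun p => Y p.1 p.2) ((coordEquiv h).symm a)

theorem coordX_mk {k n : ℕ} (h : k + 2 ≤ n) (X : Matrix (Fin k) (Fin 2 ⊕ Fin (n - k - 2)) ℝ)
    (Y : Matrix (Fin 2) (Fin (n - k - 2)) ℝ) : coordX h (coordMk h X Y) = X := by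
  ext i j; simp [coordX, coordMk]

theorem coordY_mk {k n : ℕ} (h : k + 2 ≤ n) (X : Matrix (Fin k) (Fin 2 ⊕ Fin (n - k - 2)) ℝ)
    (Y : Matrix (Fin 2) (Fin (n - k - 2)) ℝ) : coordY h (coordMk h X Y) = Y := by
  ext i j; simp [coordY, coordMk]

theorem coord_ext {k n : ℕ} (h : k + 2 ≤ n) {x y : Coord k n} (hX : coordX h x = coordX h y)
    (hY : coordY h x = coordY h y) : x = y := by
  ext a
  obtain ⟨b, rfl⟩ := (coordEquiv h).surjective a
  rcases b with ⟨i, j⟩ | ⟨i, j⟩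
  · exact congrFun (congrFun hX i) j
  · exact congrFun (congrFun hY i) j

/-- The matrix `(1 | X) g`. -/
def pairC {k n : ℕ} (h : k + 2 ≤ n) (g : Frame k n) (x : Coord k n) : Matrix (Fin k) (Fin n) ℝ :=
  Matrix.fromCols (1 : Matrix (Fin k) (Fin k) ℝ) (coordX h x) * g.mat

/-- The matrix `(0 | 1 | Y) g`. -/
def pairD {k n : ℕ} (h : k + 2 ≤ n) (g : Frame k n) (x : Coord k n) : Matrix (Fin 2) (Fin n) ℝ :=
  Matrix.fromCols (0 : Matrix (Fin 2) (Fin k) ℝ)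
    (Matrix.fromCols (1 : Matrix (Fin 2) (Fin 2) ℝ) (coordY h x)) * g.mat

theorem Frame.cancel {k n : ℕ} (g : Frame k n) {ι : Type*}
    (A : Matrix ι (Fin k ⊕ (Fin 2 ⊕ Fin (n - k - 2))) ℝ) : A * g.mat * g.inv = A := by
  rw [Matrix.mul_assoc, g.mat_mul_inv, Matrix.mul_one]

theorem Frame.cancel' {k n : ℕ} (g : Frame k n) {ι : Type*}
    (A : Matrix ι (Fin n) ℝ) : A * g.inv * g.mat = A := by
  rw [Matrix.mul_assoc, g.inv_mul_mat, Matrix.mul_one]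

theorem stack_rank_of_indep {k n : ℕ} {C : Matrix (Fin k) (Fin n) ℝ}
    {D : Matrix (Fin 2) (Fin n) ℝ}
    (hC : ∀ a : Fin k → ℝ, ∀ b : Fin 2 → ℝ, a ᵥ* C + b ᵥ* D = 0 → a = 0 ∧ b = 0) :
    C.rank = k ∧ (stack C D).rank = k + 2 := by
  have h1 : LinearIndependent ℝ C.row := by
    rw [← Matrix.vecMul_injective_iff]
    refine (injective_iff_map_eq_zero C.vecMulLinear).2 fun a ha => ?_
    have : a ᵥ* C = 0 := ha
    exact (hC a 0 (by simp [this])).1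
  have h2 : LinearIndependent ℝ D.row := by
    rw [← Matrix.vecMul_injective_iff]
    refine (injective_iff_map_eq_zero D.vecMulLinear).2 fun a ha => ?_
    have : a ᵥ* D = 0 := ha
    exact (hC 0 a (by simp [this])).2
  have r1 := h1.rank_matrix
  have r2 := h2.rank_matrix
  simp only [Fintype.card_fin] at r1 r2
  refine ⟨r1, ?_⟩
  rw [rank_eq_finrank_rowSpan, rowSpan_stack]
  have h3 := Submodule.finrank_sup_add_finrank_inf_eq (rowSpan C) (rowSpan D)
  have h4 : rowSpan C ⊓ rowSpan D = ⊥ := by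
    rw [eq_bot_iff]
    rintro v ⟨hv1, hv2⟩
    obtain ⟨a, ha⟩ := mem_rowSpan.1 hv1
    obtain ⟨b, hb⟩ := mem_rowSpan.1 hv2
    have := (hC a (-b) (by rw [Matrix.neg_vecMul, ha, hb, add_neg_cancel])).1
    subst this
    simpa using ha.symm
  rw [h4, finrank_bot, ← rank_eq_finrank_rowSpan, ← rank_eq_finrank_rowSpan, r1, r2] at h3
  omega

theorem pair_fullRank {k n : ℕ} (h : k + 2 ≤ n) (g : Frame k n) (x : Coord k n) :
    (pairC h g x).rank = k ∧ (stack (pairC h g x) (pairD h g x)).rank = k + 2 := by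
  refine stack_rank_of_indep fun a b hab => ?_
  have h1 : a ᵥ* Matrix.fromCols (1 : Matrix (Fin k) (Fin k) ℝ) (coordX h x) +
      b ᵥ* Matrix.fromCols (0 : Matrix (Fin 2) (Fin k) ℝ)
        (Matrix.fromCols (1 : Matrix (Fin 2) (Fin 2) ℝ) (coordY h x)) = 0 := by
    have := congrArg (fun v => v ᵥ* g.inv) hab
    simpa [pairC, pairD, Matrix.add_vecMul, Matrix.vecMul_vecMul, Frame.cancel] using this
  rw [Matrix.vecMul_fromCols, Matrix.vecMul_fromCols, Matrix.vecMul_fromCols] at h1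
  have ha : a = 0 := by
    ext i
    have := congrFun h1 (Sum.inl i)
    simpa using this
  subst ha
  refine ⟨rfl, ?_⟩
  ext i
  have := congrFun h1 (Sum.inr (Sum.inl i))
  simpa using this

/-- The parametrization of an affine chart of the flag variety. -/
def param {k n : ℕ} (h : k + 2 ≤ n) (g : Frame k n) (x : Coord k n) : Flag k n :=
  Flag.proj ⟨(pairC h g x, pairD h g x), pair_fullRank h g x⟩

theorem proj_eq_of {k n : ℕ} {P Q : FullRankPair k n} {M : Matrix (Fin k) (Fin k) ℝ}
    {N : Matrix (Fin 2) (Fin 2) ℝ} {K : Matrix (Fin 2) (Fin k) ℝ}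
    (hC : Q.1.1 = M * P.1.1) (hD : Q.1.2 = N * P.1.2 + K * P.1.1) : Flag.proj P = Flag.proj Q := by
  have hU : (Flag.proj Q).U ≤ (Flag.proj P).U := rowSpan_le_iff.2 ⟨M, hC⟩
  have hW : (Flag.proj Q).W ≤ (Flag.proj P).W := by
    refine sup_le (hU.trans le_sup_left) (Submodule.span_le.2 ?_)
    rintro _ ⟨i, rfl⟩
    have : Q.1.2.row i = (K i) ᵥ* P.1.1 + (N i) ᵥ* P.1.2 := by
      rw [hD, add_comm]; rfl
    rw [this]
    exact Submodule.add_mem_sup (mem_rowSpan.2 ⟨_, rfl⟩) (mem_rowSpan.2 ⟨_, rfl⟩)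
  ext1
  · exact (Submodule.eq_of_le_of_finrank_eq hU
      ((Flag.proj Q).finrank_U.trans (Flag.proj P).finrank_U.symm)).symm
  · exact (Submodule.eq_of_le_of_finrank_eq hW
      ((Flag.proj Q).finrank_W.trans (Flag.proj P).finrank_W.symm)).symm

theorem exists_of_proj_eq {k n : ℕ} {P Q : FullRankPair k n} (hPQ : Flag.proj P = Flag.proj Q) :
    ∃ (M : Matrix (Fin k) (Fin k) ℝ) (N : Matrix (Fin 2) (Fin 2) ℝ) (K : Matrix (Fin 2) (Fin k) ℝ),
      Q.1.1 = M * P.1.1 ∧ Q.1.2 = N * P.1.2 + K * P.1.1 := by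
  obtain ⟨M, hM⟩ := rowSpan_le_iff.1 (show rowSpan Q.1.1 ≤ rowSpan P.1.1 from
    (congrArg Flag.U hPQ).ge)
  have hW : rowSpan Q.1.2 ≤ rowSpan P.1.1 ⊔ rowSpan P.1.2 :=
    le_sup_right.trans (congrArg Flag.W hPQ).ge
  have h1 : ∀ i, ∃ c : (Fin k → ℝ) × (Fin 2 → ℝ), c.1 ᵥ* P.1.1 + c.2 ᵥ* P.1.2 = Q.1.2 i := by
    intro i
    obtain ⟨u, hu, v, hv, huv⟩ := Submodule.mem_sup.1 (hW (Submodule.subset_span ⟨i, rfl⟩))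
    obtain ⟨a, rfl⟩ := mem_rowSpan.1 hu
    obtain ⟨b, rfl⟩ := mem_rowSpan.1 hv
    exact ⟨(a, b), huv⟩
  choose c hc using h1
  refine ⟨M, Matrix.of fun i => (c i).2, Matrix.of fun i => (c i).1, hM, ?_⟩
  ext i j
  rw [← hc i, add_comm]
  rfl

theorem param_injective {k n : ℕ} (h : k + 2 ≤ n) (g : Frame k n) :
    Function.Injective (param h g) := by
  intro x y hxy
  obtain ⟨M, N, K, h1, h2⟩ := exists_of_proj_eq hxy
  have e1 := congrArg (· * g.inv) h1
  have e2 := congrArg (· * g.inv) h2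
  simp only [pairC, pairD, Matrix.add_mul] at e1 e2
  simp only [← Matrix.mul_assoc] at e1 e2
  simp only [Frame.cancel] at e1 e2
  simp only [Matrix.mul_fromCols, Matrix.fromCols_ext_iff, Matrix.mul_one, Matrix.mul_zero] at e1 e2
  obtain ⟨rfl, e1⟩ := e1
  have hK : K = 0 := by
    ext i j
    have := congrFun (congrFun e2 i) (Sum.inl j)
    simpa using this.symm
  subst hK
  have hN : N = 1 := by
    ext i j
    have := congrFun (congrFun e2 i) (Sum.inr (Sum.inl j))
    simpa using this.symm
  subst hN
  refine coord_ext h (by simpa using e1.symm) ?_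
  ext i j
  have := congrFun (congrFun e2 i) (Sum.inr (Sum.inr j))
  simpa using this.symm

/-! The coordinates of a flag, computed from a representative. -/

/-- The leading `k × k` block of `C` in the frame `g`. -/
def leadC {k n : ℕ} (g : Frame k n) (P : FullRankPair k n) : Matrix (Fin k) (Fin k) ℝ :=
  (P.1.1 * g.inv).toCols₁

/-- The coordinate matrix `X` of the flag of a representative. -/
def solveX {k n : ℕ} (g : Frame k n) (P : FullRankPair k n) :
    Matrix (Fin k) (Fin 2 ⊕ Fin (n - k - 2)) ℝ :=
  (leadC g P)⁻¹ * (P.1.1 * g.inv).toCols₂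

/-- The matrix `D` in the frame `g` after elimination of its first `k` columns. -/
def elimD {k n : ℕ} (g : Frame k n) (P : FullRankPair k n) :
    Matrix (Fin 2) (Fin 2 ⊕ Fin (n - k - 2)) ℝ :=
  (P.1.2 * g.inv).toCols₂ - (P.1.2 * g.inv).toCols₁ * solveX g P

/-- The coordinate matrix `Y` of the flag of a representative. -/
def solveY {k n : ℕ} (g : Frame k n) (P : FullRankPair k n) :
    Matrix (Fin 2) (Fin (n - k - 2)) ℝ :=
  (elimD g P).toCols₁⁻¹ * (elimD g P).toCols₂

/-- The representatives of the flags in the domain of the chart of the frame `g`. -/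
def solvable {k n : ℕ} (g : Frame k n) : Set (FullRankPair k n) :=
  {P | (leadC g P).det ≠ 0 ∧ (elimD g P).toCols₁.det ≠ 0}

theorem proj_eq_param {k n : ℕ} (h : k + 2 ≤ n) (g : Frame k n) {P : FullRankPair k n}
    (hP : P ∈ solvable g) : Flag.proj P = param h g (coordMk h (solveX g P) (solveY g P)) := by
  obtain ⟨hA, hS⟩ := hP
  have hA' : IsUnit (leadC g P).det := isUnit_iff_ne_zero.2 hA
  have hS' : IsUnit (elimD g P).toCols₁.det := isUnit_iff_ne_zero.2 hS
  have e1 : Matrix.fromCols 1 (solveX g P) = (leadC g P)⁻¹ * (P.1.1 * g.inv) := by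
    conv_rhs => rw [← Matrix.fromCols_toCols (P.1.1 * g.inv)]
    rw [Matrix.mul_fromCols, ← leadC, Matrix.nonsing_inv_mul _ hA', ← solveX]
  have e2 : Matrix.fromCols 0 (Matrix.fromCols 1 (solveY g P)) =
      (elimD g P).toCols₁⁻¹ * (P.1.2 * g.inv -
        (P.1.2 * g.inv).toCols₁ * Matrix.fromCols 1 (solveX g P)) := by
    have h1 : P.1.2 * g.inv - (P.1.2 * g.inv).toCols₁ * Matrix.fromCols 1 (solveX g P) =
        Matrix.fromCols 0 (elimD g P) := by
      conv_lhs => enter [1]; rw [← Matrix.fromCols_toCols (P.1.2 * g.inv)]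
      rw [Matrix.mul_fromCols, Matrix.mul_one]
      ext i (j | j) <;> simp [elimD]
    rw [h1, Matrix.mul_fromCols, Matrix.mul_zero, solveY]
    congr 1
    conv_rhs => enter [2]; rw [← Matrix.fromCols_toCols (elimD g P)]
    rw [Matrix.mul_fromCols, Matrix.nonsing_inv_mul _ hS']
  refine proj_eq_of (M := (leadC g P)⁻¹) (N := (elimD g P).toCols₁⁻¹)
    (K := -((elimD g P).toCols₁⁻¹ * ((P.1.2 * g.inv).toCols₁ * (leadC g P)⁻¹))) ?_ ?_
  · simp only [pairC, coordX_mk, e1]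
    rw [Matrix.mul_assoc, Frame.cancel']
  · simp only [pairD, coordY_mk, e2, e1]
    rw [Matrix.mul_sub, Matrix.sub_mul, Matrix.neg_mul, ← sub_eq_add_neg]
    congr 1
    · rw [Matrix.mul_assoc, Frame.cancel']
    · simp only [Matrix.mul_assoc, g.inv_mul_mat, Matrix.mul_one]

theorem proj_mem_range {k n : ℕ} (h : k + 2 ≤ n) (g : Frame k n) (P : FullRankPair k n) :
    Flag.proj P ∈ Set.range (param h g) ↔ P ∈ solvable g := by
  refine ⟨?_, fun hP => ⟨_, (proj_eq_param h g hP).symm⟩⟩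
  rintro ⟨x, hx⟩
  obtain ⟨M, N, K, h1, h2⟩ := exists_of_proj_eq hx
  obtain ⟨M', N', K', h1', h2'⟩ := exists_of_proj_eq hx.symm
  have hM : M' * M = 1 := by
    rw [h1, ← Matrix.mul_assoc] at h1'
    have e := congrArg (· * g.inv) h1'
    simp only [pairC] at e
    rw [← Matrix.mul_assoc, Frame.cancel, Frame.cancel, Matrix.mul_fromCols,
      Matrix.fromCols_ext_iff, Matrix.mul_one] at e
    exact e.1.symm
  have hMu : IsUnit M.det := by
    refine isUnit_iff_ne_zero.2 fun h0 => ?_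
    have := congrArg Matrix.det hM
    simp [h0] at this
  have eC : P.1.1 * g.inv = Matrix.fromCols M (M * coordX h x) := by
    rw [h1]
    simp only [pairC]
    rw [← Matrix.mul_assoc, Frame.cancel, Matrix.mul_fromCols, Matrix.mul_one]
  have eD : P.1.2 * g.inv =
      Matrix.fromCols K (N * Matrix.fromCols 1 (coordY h x) + K * coordX h x) := by
    rw [h2]
    simp only [pairC, pairD, Matrix.add_mul]
    rw [← Matrix.mul_assoc, ← Matrix.mul_assoc, Frame.cancel, Frame.cancel, Matrix.mul_fromCols,
      Matrix.mul_fromCols, Matrix.mul_one, Matrix.mul_zero]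
    ext i (j | j) <;> simp
  have eA : leadC g P = M := by rw [leadC, eC, Matrix.toCols₁_fromCols]
  have eX : solveX g P = coordX h x := by
    rw [solveX, eA, eC, Matrix.toCols₂_fromCols, ← Matrix.mul_assoc,
      Matrix.nonsing_inv_mul _ hMu, Matrix.one_mul]
  have eE : elimD g P = Matrix.fromCols N (N * coordY h x) := by
    rw [elimD, eD, eX, Matrix.toCols₁_fromCols, Matrix.toCols₂_fromCols, add_sub_cancel_right,
      Matrix.mul_fromCols, Matrix.mul_one]
  have hN : N' * N = 1 := by
    rw [h2] at h2'
    have e := congrArg (· * g.inv) h2'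
    simp only [Matrix.mul_add, Matrix.add_mul] at e
    rw [h1] at e
    simp only [pairC, pairD, ← Matrix.mul_assoc] at e
    simp only [Frame.cancel, Matrix.mul_fromCols, Matrix.mul_one, Matrix.mul_zero] at e
    have e0 : N' * K + K' * M = 0 := by
      ext i j
      have := congrFun (congrFun e i) (Sum.inl j)
      simpa using this.symm
    have e3 : N' * K * coordX h x + K' * M * coordX h x = 0 := by
      rw [← Matrix.add_mul, e0, Matrix.zero_mul]
    ext i j
    have h3 := congrFun (congrFun e i) (Sum.inr (Sum.inl j))
    have h4 := congrFun (congrFun e3 i) (Sum.inl j)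
    simp only [Matrix.add_apply, Matrix.fromCols_apply_inr, Matrix.fromCols_apply_inl,
      Matrix.zero_apply] at h3 h4
    linarith
  refine ⟨by rw [eA]; exact hMu.ne_zero, ?_⟩
  rw [eE, Matrix.toCols₁_fromCols]
  intro h0
  have := congrArg Matrix.det hN
  simp [h0] at this

/-! Existence of representatives and of adapted frames. -/

theorem exists_rows {n r : ℕ} (V : Submodule ℝ (Fin n → ℝ)) (hV : Module.finrank ℝ V = r) :
    ∃ M : Matrix (Fin r) (Fin n) ℝ, rowSpan M = V := by
  let b := Module.finBasisOfFinrankEq ℝ V hV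
  refine ⟨Matrix.of fun i => (b i : Fin n → ℝ), ?_⟩
  have h1 := congrArg (Submodule.map V.subtype) b.span_eq
  rw [Submodule.map_span, Submodule.map_top, Submodule.range_subtype, ← Set.range_comp] at h1
  exact h1

theorem le_of_flag {k n : ℕ} (F : Flag k n) : k + 2 ≤ n := by
  have := Submodule.finrank_le F.W
  rw [F.finrank_W] at this
  simpa using this

theorem exists_pair {k n : ℕ} (F : Flag k n) : ∃ P : FullRankPair k n, Flag.proj P = F := by
  obtain ⟨V0, hV0⟩ := exists_isCompl F.U
  have hsup : F.U ⊔ V0 ⊓ F.W = F.W := by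
    rw [← sup_inf_assoc_of_le _ F.le, hV0.sup_eq_top, top_inf_eq]
  have hinf : F.U ⊓ (V0 ⊓ F.W) = ⊥ := by
    rw [← inf_assoc, hV0.inf_eq_bot, bot_inf_eq]
  have hdim := Submodule.finrank_sup_add_finrank_inf_eq F.U (V0 ⊓ F.W)
  rw [hsup, hinf, finrank_bot, F.finrank_U, F.finrank_W] at hdim
  obtain ⟨C, hC⟩ := exists_rows F.U F.finrank_U
  obtain ⟨D, hD⟩ := exists_rows (r := 2) (V0 ⊓ F.W) (by omega)
  refine ⟨⟨(C, D), ?_, ?_⟩, ?_⟩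
  · rw [rank_eq_finrank_rowSpan, hC, F.finrank_U]
  · rw [rank_eq_finrank_rowSpan, rowSpan_stack, hC, hD, hsup, F.finrank_W]
  · ext1
    · exact hC
    · show rowSpan C ⊔ rowSpan D = F.W
      rw [hC, hD, hsup]

theorem exists_frame {k n : ℕ} (F : Flag k n) (h : k + 2 ≤ n) :
    ∃ g : Frame k n, F ∈ Set.range (param h g) := by
  obtain ⟨P, rfl⟩ := exists_pair F
  obtain ⟨Q, hQ⟩ := exists_isCompl (Flag.proj P).W
  have hdim := Submodule.finrank_add_eq_of_isCompl hQ
  rw [(Flag.proj P).finrank_W, Module.finrank_fin_fun] at hdim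
  obtain ⟨E, hE⟩ := exists_rows (r := n - k - 2) Q (by omega)
  have htop : rowSpan P.1.1 ⊔ rowSpan P.1.2 ⊔ rowSpan E = ⊤ := by
    rw [hE]; exact hQ.sup_eq_top
  let B : Matrix (Fin k ⊕ (Fin 2 ⊕ Fin (n - k - 2))) (Fin n) ℝ :=
    Matrix.fromRows P.1.1 (Matrix.fromRows P.1.2 E)
  have hB : rowSpan B = ⊤ := by
    rw [eq_top_iff, ← htop]
    refine sup_le (sup_le ?_ ?_) ?_ <;> refine Submodule.span_mono ?_
    · rintro _ ⟨i, rfl⟩; exact ⟨Sum.inl i, rfl⟩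
    · rintro _ ⟨i, rfl⟩; exact ⟨Sum.inr (Sum.inl i), rfl⟩
    · rintro _ ⟨i, rfl⟩; exact ⟨Sum.inr (Sum.inr i), rfl⟩
  obtain ⟨N, hN⟩ := rowSpan_le_iff.1 (show rowSpan (1 : Matrix (Fin n) (Fin n) ℝ) ≤ rowSpan B by
    rw [hB]; exact le_top)
  have hcard : Fintype.card (Fin n) = Fintype.card (Fin k ⊕ (Fin 2 ⊕ Fin (n - k - 2))) := by
    simp only [Fintype.card_sum, Fintype.card_fin]; omega
  have hBN : B * N = 1 :=
    (Matrix.mul_eq_one_comm_of_equiv (Fintype.equivOfCardEq hcard)).1 hN.symm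
  refine ⟨⟨B, N, hBN, hN.symm⟩, (proj_mem_range h _ P).2 ?_⟩
  have h1 : Matrix.fromRows (P.1.1 * N) (Matrix.fromRows (P.1.2 * N) (E * N)) = 1 := by
    rw [← Matrix.fromRows_mul, ← Matrix.fromRows_mul]; exact hBN
  have hC : P.1.1 * N = Matrix.fromCols 1 0 := by
    ext i (j | j)
    · have := congrFun (congrFun h1 (Sum.inl i)) (Sum.inl j)
      simpa [Matrix.one_apply] using this
    · have := congrFun (congrFun h1 (Sum.inl i)) (Sum.inr j)
      simpa [Matrix.one_apply] using this
  have hD : P.1.2 * N = Matrix.fromCols 0 (Matrix.fromCols 1 0) := by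
    ext i (j | j | j)
    · have := congrFun (congrFun h1 (Sum.inr (Sum.inl i))) (Sum.inl j)
      simpa [Matrix.one_apply] using this
    · have := congrFun (congrFun h1 (Sum.inr (Sum.inl i))) (Sum.inr (Sum.inl j))
      simpa [Matrix.one_apply] using this
    · have := congrFun (congrFun h1 (Sum.inr (Sum.inl i))) (Sum.inr (Sum.inr j))
      simpa [Matrix.one_apply] using this
  constructor
  · simp [leadC, hC]
  · simp [elimD, hD]

/-! Continuity and smoothness of the change of coordinates. -/

theorem isQuotientMap_proj (k n : ℕ) :
    Topology.IsQuotientMap (Flag.proj : FullRankPair k n → Flag k n) where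
  surjective := exists_pair
  eq_coinduced := rfl

theorem continuous_fromCols {α ι κ κ' : Type*} [TopologicalSpace α] {f : α → Matrix ι κ ℝ}
    {g : α → Matrix ι κ' ℝ} (hf : Continuous f) (hg : Continuous g) :
    Continuous fun a => Matrix.fromCols (f a) (g a) := by
  refine continuous_matrix fun i j => ?_
  rcases j with j | j
  · exact hf.matrix_elem i j
  · exact hg.matrix_elem i j

theorem continuous_param {k n : ℕ} (h : k + 2 ≤ n) (g : Frame k n) :
    Continuous (param h g) := by
  have hX : Continuous (coordX h) := continuous_matrix fun i j => by
    simp only [coordX, Matrix.of_apply]; fun_prop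
  have hY : Continuous (coordY h) := continuous_matrix fun i j => by
    simp only [coordY, Matrix.of_apply]; fun_prop
  refine (isQuotientMap_proj k n).continuous.comp (Continuous.subtype_mk (Continuous.prodMk ?_ ?_) _)
  · exact (continuous_fromCols continuous_const hX).matrix_mul continuous_const
  · exact (continuous_fromCols continuous_const
      (continuous_fromCols continuous_const hY)).matrix_mul continuous_const

theorem continuousAt_inv {ι : Type*} [Fintype ι] [DecidableEq ι] {A : Matrix ι ι ℝ}
    (hA : A.det ≠ 0) : ContinuousAt (fun B : Matrix ι ι ℝ => B⁻¹) A :=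
  continuousAt_matrix_inv A (by rw [Ring.inverse_eq_inv']; exact continuousAt_inv₀ hA)

theorem continuous_leadC {k n : ℕ} (g : Frame k n) : Continuous (leadC g) :=
  continuous_matrix fun i j =>
    ((continuous_fst.comp continuous_subtype_val).matrix_mul continuous_const).matrix_elem i
      (Sum.inl j)

theorem continuousAt_solveX {k n : ℕ} (g : Frame k n) {P : FullRankPair k n}
    (hP : (leadC g P).det ≠ 0) : ContinuousAt (solveX g) P := by
  have h1 : ContinuousAt (fun P => (leadC g P)⁻¹) P :=
    (continuousAt_inv hP).comp (continuous_leadC g).continuousAt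
  have h2 : Continuous fun P : FullRankPair k n => (P.1.1 * g.inv).toCols₂ :=
    continuous_matrix fun i j =>
      ((continuous_fst.comp continuous_subtype_val).matrix_mul continuous_const).matrix_elem i
        (Sum.inr j)
  exact (continuous_fst.matrix_mul continuous_snd).continuousAt.comp
    (h1.prodMk h2.continuousAt)

theorem continuousAt_elimD {k n : ℕ} (g : Frame k n) {P : FullRankPair k n}
    (hP : (leadC g P).det ≠ 0) : ContinuousAt (elimD g) P := by
  have h0 : Continuous fun P : FullRankPair k n => P.1.2 * g.inv :=
    (continuous_snd.comp continuous_subtype_val).matrix_mul continuous_const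
  have h1 : Continuous fun P : FullRankPair k n => (P.1.2 * g.inv).toCols₁ :=
    continuous_matrix fun i j => h0.matrix_elem i (Sum.inl j)
  have h2 : Continuous fun P : FullRankPair k n => (P.1.2 * g.inv).toCols₂ :=
    continuous_matrix fun i j => h0.matrix_elem i (Sum.inr j)
  exact h2.continuousAt.sub ((continuous_fst.matrix_mul continuous_snd).continuousAt.comp
    (h1.continuousAt.prodMk (continuousAt_solveX g hP)))

theorem continuous_toCols₁ {ι κ κ' : Type*} :
    Continuous fun A : Matrix ι (κ ⊕ κ') ℝ => A.toCols₁ :=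
  continuous_matrix fun i j => continuous_id.matrix_elem i (Sum.inl j)

theorem continuous_toCols₂ {ι κ κ' : Type*} :
    Continuous fun A : Matrix ι (κ ⊕ κ') ℝ => A.toCols₂ :=
  continuous_matrix fun i j => continuous_id.matrix_elem i (Sum.inr j)

theorem isOpen_solvable {k n : ℕ} (g : Frame k n) : IsOpen (solvable g) := by
  have h1 : IsOpen {P : FullRankPair k n | (leadC g P).det ≠ 0} :=
    isOpen_ne_fun (continuous_leadC g).matrix_det continuous_const
  have h2 : ContinuousOn (fun P : FullRankPair k n => (elimD g P).toCols₁.det)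
      {P | (leadC g P).det ≠ 0} := fun P hP =>
    ((continuous_toCols₁.matrix_det.continuousAt).comp
      (continuousAt_elimD g hP)).continuousWithinAt
  exact h2.isOpen_inter_preimage h1 isOpen_ne

theorem continuousAt_solveY {k n : ℕ} (g : Frame k n) {P : FullRankPair k n}
    (hP : P ∈ solvable g) : ContinuousAt (solveY g) P := by
  have h1 : ContinuousAt (fun P => (elimD g P).toCols₁) P :=
    continuous_toCols₁.continuousAt.comp (continuousAt_elimD g hP.1)
  have h2 : ContinuousAt (fun P => (elimD g P).toCols₂) P :=
    continuous_toCols₂.continuousAt.comp (continuousAt_elimD g hP.1)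
  have h3 : ContinuousAt (fun P => (elimD g P).toCols₁⁻¹) P :=
    ContinuousAt.comp (g := fun B : Matrix (Fin 2) (Fin 2) ℝ => B⁻¹) (continuousAt_inv hP.2) h1
  exact (continuous_fst.matrix_mul continuous_snd).continuousAt.comp (h3.prodMk h2)

theorem continuousAt_solve {k n : ℕ} (h : k + 2 ≤ n) (g : Frame k n) {P : FullRankPair k n}
    (hP : P ∈ solvable g) :
    ContinuousAt (fun P => coordMk h (solveX g P) (solveY g P)) P := by
  refine (PiLp.continuous_toLp 2 _).continuousAt.comp (continuousAt_pi.2 fun a => ?_)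
  rcases (coordEquiv h).symm a with ⟨i, j⟩ | ⟨i, j⟩
  · exact ((continuous_id.matrix_elem i j).continuousAt).comp (continuousAt_solveX g hP.1)
  · exact ((continuous_id.matrix_elem i j).continuousAt).comp (continuousAt_solveY g hP)

theorem invFun_param_proj {k n : ℕ} (h : k + 2 ≤ n) (g : Frame k n) {P : FullRankPair k n}
    (hP : P ∈ solvable g) :
    Function.invFun (param h g) (Flag.proj P) = coordMk h (solveX g P) (solveY g P) := by
  rw [proj_eq_param h g hP]
  exact Function.leftInverse_invFun (param_injective h g) _

theorem preimage_range_param {k n : ℕ} (h : k + 2 ≤ n) (g : Frame k n) :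
    Flag.proj ⁻¹' Set.range (param h g) = solvable g :=
  Set.ext fun P => proj_mem_range h g P

theorem isOpen_range_param {k n : ℕ} (h : k + 2 ≤ n) (g : Frame k n) :
    IsOpen (Set.range (param h g)) := by
  rw [← (isQuotientMap_proj k n).isOpen_preimage, preimage_range_param]
  exact isOpen_solvable g

/-- The affine chart of the flag variety given by a frame. -/
def chart {k n : ℕ} (h : k + 2 ≤ n) (g : Frame k n) :
    OpenPartialHomeomorph (Flag k n) (Coord k n) where
  toFun := Function.invFun (param h g)
  invFun := param h g
  source := Set.range (param h g)
  target := Set.univ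
  map_source' := fun _ _ => Set.mem_univ _
  map_target' := fun x _ => Set.mem_range_self x
  left_inv' := fun _ hF => Function.invFun_eq hF
  right_inv' := fun x _ => Function.leftInverse_invFun (param_injective h g) x
  open_source := isOpen_range_param h g
  open_target := isOpen_univ
  continuousOn_toFun := by
    rw [(isQuotientMap_proj k n).continuousOn_isOpen_iff (isOpen_range_param h g),
      preimage_range_param]
    intro P hP
    exact ((continuousAt_solve h g hP).continuousWithinAt).congr
      (fun Q hQ => invFun_param_proj h g hQ) (invFun_param_proj h g hP)
  continuousOn_invFun := (continuous_param h g).continuousOn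

/-- The flag variety is a topological manifold of dimension `k (n - k) + 2 (n - k - 2)`. -/
instance (k n : ℕ) : ChartedSpace (Coord k n) (Flag k n) where
  atlas := {e | ∃ (h : k + 2 ≤ n) (g : Frame k n), e = chart h g}
  chartAt F := chart (le_of_flag F) (exists_frame F (le_of_flag F)).choose
  mem_chart_source F := (exists_frame F (le_of_flag F)).choose_spec
  chart_mem_atlas F := ⟨le_of_flag F, _, rfl⟩

/-- A matrix valued function with smooth entries. -/
def SmoothEntries {E ι κ : Type*} [NormedAddCommGroup E] [NormedSpace ℝ E]
    (f : E → Matrix ι κ ℝ) (x : E) : Prop :=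
  ∀ i j, ContDiffAt ℝ ∞ (fun y => f y i j) x

section Smooth

variable {E ι κ μ : Type*} [NormedAddCommGroup E] [NormedSpace ℝ E] {x : E}

theorem smoothEntries_const (A : Matrix ι κ ℝ) : SmoothEntries (fun _ : E => A) x :=
  fun _ _ => contDiffAt_const

theorem SmoothEntries.mul [Fintype κ] {f : E → Matrix ι κ ℝ} {g : E → Matrix κ μ ℝ}
    (hf : SmoothEntries f x) (hg : SmoothEntries g x) : SmoothEntries (fun y => f y * g y) x := by
  intro i j
  simp only [Matrix.mul_apply]
  exact ContDiffAt.sum fun l _ => (hf i l).mul (hg l j)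

theorem SmoothEntries.sub {f g : E → Matrix ι κ ℝ}
    (hf : SmoothEntries f x) (hg : SmoothEntries g x) : SmoothEntries (fun y => f y - g y) x :=
  fun i j => (hf i j).sub (hg i j)

theorem SmoothEntries.det [Fintype ι] [DecidableEq ι] {f : E → Matrix ι ι ℝ}
    (hf : SmoothEntries f x) : ContDiffAt ℝ ∞ (fun y => (f y).det) x := by
  simp only [Matrix.det_apply']
  exact ContDiffAt.sum fun σ _ => contDiffAt_const.mul (contDiffAt_prod fun i _ => hf _ _)

theorem SmoothEntries.inv [Fintype ι] [DecidableEq ι] {f : E → Matrix ι ι ℝ}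
    (hf : SmoothEntries f x) (h0 : (f x).det ≠ 0) : SmoothEntries (fun y => (f y)⁻¹) x := by
  intro i j
  simp only [Matrix.inv_def, Ring.inverse_eq_inv', Matrix.smul_apply, smul_eq_mul,
    Matrix.adjugate_apply]
  refine (hf.det.inv h0).mul (SmoothEntries.det fun a b => ?_)
  by_cases haj : a = j
  · subst haj
    simp only [Matrix.updateRow_self]
    exact contDiffAt_const
  · simp only [Matrix.updateRow_ne haj]
    exact hf a b

end Smooth

theorem contDiffAt_change {k n : ℕ} (h : k + 2 ≤ n) (g g' : Frame k n) {x : Coord k n}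
    (hx : param h g x ∈ Set.range (param h g')) :
    ContDiffAt ℝ ∞ (fun y => Function.invFun (param h g') (param h g y)) x := by
  let P : Coord k n → FullRankPair k n := fun y => ⟨(pairC h g y, pairD h g y), pair_fullRank h g y⟩
  have hcoord : ∀ a : Fin (flagDim k n), ContDiffAt ℝ ∞ (fun y : Coord k n => y a) x := fun a => by
    fun_prop
  have hC : SmoothEntries (fun y => pairC h g y) x := by
    refine SmoothEntries.mul (fun i j => ?_) (smoothEntries_const _)
    rcases j with j | j
    · exact contDiffAt_const
    · exact hcoord _
  have hD : SmoothEntries (fun y => pairD h g y) x := by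
    refine SmoothEntries.mul (fun i j => ?_) (smoothEntries_const _)
    rcases j with j | j | j
    · exact contDiffAt_const
    · exact contDiffAt_const
    · exact hcoord _
  have hs : P x ∈ solvable g' := (proj_mem_range h g' (P x)).1 hx
  have hC' : SmoothEntries (fun y => (P y).1.1 * g'.inv) x := hC.mul (smoothEntries_const _)
  have hD' : SmoothEntries (fun y => (P y).1.2 * g'.inv) x := hD.mul (smoothEntries_const _)
  have hA : SmoothEntries (fun y => leadC g' (P y)) x := fun i j => hC' i (Sum.inl j)
  have hX : SmoothEntries (fun y => solveX g' (P y)) x :=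
    (hA.inv hs.1).mul fun i j => hC' i (Sum.inr j)
  have hE : SmoothEntries (fun y => elimD g' (P y)) x := by
    refine SmoothEntries.sub (fun i j => hD' i (Sum.inr j)) (SmoothEntries.mul (fun i j => ?_) hX)
    exact hD' i (Sum.inl j)
  have hS : SmoothEntries (fun y => (elimD g' (P y)).toCols₁) x := fun i j => hE i (Sum.inl j)
  have hY : SmoothEntries (fun y => solveY g' (P y)) x :=
    (hS.inv hs.2).mul fun i j => hE i (Sum.inr j)
  have hfin : ContDiffAt ℝ ∞ (fun y => coordMk h (solveX g' (P y)) (solveY g' (P y))) x := by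
    refine (contDiffAt_piLp 2).2 fun a => ?_
    simp only [coordMk]
    rcases (coordEquiv h).symm a with ⟨i, j⟩ | ⟨i, j⟩
    · exact hX i j
    · exact hY i j
  refine hfin.congr_of_eventuallyEq ?_
  filter_upwards [(continuous_param h g).continuousAt.preimage_mem_nhds
    ((isOpen_range_param h g').mem_nhds hx)] with y hy
  exact invFun_param_proj h g' ((proj_mem_range h g' (P y)).1 hy)

/-- The flag variety is a smooth manifold of dimension `k (n - k) + 2 (n - k - 2)`. -/
instance (k n : ℕ) :
    IsManifold (𝓡 (flagDim k n)) ∞ (Flag k n) := by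
  refine isManifold_of_contDiffOn _ _ _ ?_
  rintro _ _ ⟨h, g, rfl⟩ ⟨_, g', rfl⟩
  rintro x ⟨hx, -⟩
  refine ContDiffAt.contDiffWithinAt ?_
  exact contDiffAt_change h g g' hx.2

end Loopy

end

/-!
The proof rests on the action of totally positive matrices on flags from the right.

The Gaussian kernel `gauss n q`, with entries `q ^ ((i - j) ^ 2)`, is the identity for `q = 0`, and
for `0 < q < 1` all its minors are positive (`gauss_minor_pos`): up to positive row and column
factors they are generalized Vandermonde determinants, which are positive by Descartes' rule of
signs (`det_genVandermonde_pos`). By the Cauchy–Binet formula (`det_mul_cauchyBinet`) it maps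
nonnegative representatives to positive ones (`MinorsNonneg.mul_gauss`). Letting `q` tend to `0`,
every nonnegative flag is a limit of positive ones. Conversely, whether a flag is positive or
nonnegative can be read off from the signs of the products of two minors of any representative
(`proj_mem_posFlag`, `proj_mem_nonnegFlag`), so the positive part is open and the nonnegative part
is closed.

For connectedness a positive flag is written in the normal form `C = (X₁ | 1 | X₂)`,
`D = (1 | 0 | Y)` and contracted by positive column weights to the coordinate flag, through
nonnegative flags (`contractC_nonneg`, `contract_stack_nonneg`). Applying the Gaussian kernel for
`q = 1 / 2` to this path makes it positive, and its end does not depend on the flag. All paths live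
on the level of representatives (`exists_paths_pair`, `exists_paths_mat`), hence every continuous
image of the nonnegative part is connected; it is compact since representatives with orthonormal
rows suffice.

For the amplituhedra it remains to see that right multiplication by `Z` is injective on the row span
of an `r × n` nonnegative matrix, for `r < k + 4` (`MinorsNonneg.vecMul_eq_zero`). This is the
variation diminishing property of Gantmacher and Krein: a vector of that row span has few sign
changes (`MinorsNonneg.signChanges_le`), while a nonzero vector orthogonal to the columns of `Z` has
many (`eq_zero_of_signChanges_lt`).
-/

namespace Loopy

/-! ### The Cauchy–Binet formula -/

/-- The expansion of `det (A B)` by multilinearity in the rows. -/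
theorem det_mul_eq_sum_prod_mul_det {r n : ℕ} (A : Matrix (Fin r) (Fin n) ℝ)
    (B : Matrix (Fin n) (Fin r) ℝ) :
    (A * B).det = ∑ f : Fin r → Fin n, (∏ i, A i (f i)) * (B.submatrix f id).det := by
  have h1 : A * B = fun i => ∑ l, A i l • B l := by
    ext i j
    simp [Matrix.mul_apply, Finset.sum_apply]
  rw [h1]
  show (Matrix.detRowAlternating (R := ℝ) (n := Fin r)).toMultilinearMap
    (fun i => ∑ l, A i l • B l) = _
  rw [MultilinearMap.map_sum]
  refine Finset.sum_congr rfl fun f _ => ?_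
  rw [MultilinearMap.map_smul_univ]
  rfl

/-- Every injective map `Fin r → Fin n` is uniquely an increasing map after a permutation. -/
theorem injective_orderEmbedding_comp_perm (r n : ℕ) :
    Function.Injective fun p : (Fin r ↪o Fin n) × Equiv.Perm (Fin r) => (p.1 : _ → _) ∘ p.2 := by
  rintro ⟨I, σ⟩ ⟨I', σ'⟩ h
  simp only at h
  have hr : Set.range I = Set.range I' := by
    rw [← σ.surjective.range_comp I, ← σ'.surjective.range_comp I', h]
  obtain rfl : I = I' := DFunLike.coe_injective ((I.strictMono.range_inj I'.strictMono).1 hr)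
  refine Prod.ext rfl (Equiv.ext fun i => I.injective (congrFun h i))

theorem exists_orderEmbedding_comp_perm {r n : ℕ} {f : Fin r → Fin n}
    (hf : Function.Injective f) :
    ∃ p : (Fin r ↪o Fin n) × Equiv.Perm (Fin r), (p.1 : _ → _) ∘ p.2 = f := by
  have hm : StrictMono (f ∘ Tuple.sort f) :=
    (Tuple.monotone_sort f).strictMono_of_injective (hf.comp (Tuple.sort f).injective)
  refine ⟨(OrderEmbedding.ofStrictMono _ hm, (Tuple.sort f)⁻¹), ?_⟩
  ext i
  simp

/-- The Cauchy–Binet formula. -/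
theorem det_mul_cauchyBinet {r n : ℕ} (A : Matrix (Fin r) (Fin n) ℝ)
    (B : Matrix (Fin n) (Fin r) ℝ) :
    (A * B).det = ∑ I : Fin r ↪o Fin n, (A.submatrix id I).det * (B.submatrix I id).det := by
  rw [det_mul_eq_sum_prod_mul_det]
  symm
  have h1 : ∀ I : Fin r ↪o Fin n, (A.submatrix id I).det * (B.submatrix I id).det =
      ∑ σ : Equiv.Perm (Fin r),
        (∏ i, A i (I (σ i))) * (B.submatrix ((I : _ → _) ∘ σ) id).det := by
    intro I
    rw [← Matrix.det_transpose (A.submatrix id I), Matrix.det_apply', Finset.sum_mul]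
    refine Finset.sum_congr rfl fun σ _ => ?_
    have : B.submatrix ((I : _ → _) ∘ σ) id = (B.submatrix I id).submatrix σ id := rfl
    rw [this, Matrix.det_permute]
    simp only [Matrix.transpose_apply, Matrix.submatrix_apply, id]
    ring
  simp only [h1]
  rw [← Fintype.sum_prod_type']
  -- only the injective choices of columns contribute
  refine Fintype.sum_of_injective _ (injective_orderEmbedding_comp_perm r n) _ _ ?_ fun p => rfl
  intro f hf
  have hni : ¬ Function.Injective f := fun h => hf (exists_orderEmbedding_comp_perm h)
  simp only [Function.Injective, not_forall] at hni
  obtain ⟨i, j, hij, hne⟩ := hni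
  rw [Matrix.det_zero_of_row_eq hne (by ext l; simp [hij]), mul_zero]

/-! ### Generalized Vandermonde determinants -/

open Polynomial in
theorem signVariations_lt_card_support {p : ℝ[X]} (hp : p ≠ 0) :
    p.signVariations < p.support.card := by
  induction hc : p.support.card using Nat.strong_induction_on generalizing p with
  | _ c ih =>
    by_cases h0 : p.eraseLead = 0
    · have := signVariations_le_eraseLead_succ (P := p)
      have hm : p.signVariations = 0 := by
        rw [← p.eraseLead_add_monomial_natDegree_leadingCoeff, h0, zero_add,
          signVariations_monomial]
      rw [hm, ← hc]
      exact Finset.card_pos.2 (nonempty_support_iff.2 hp)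
    · have h1 := eraseLead_support_card_lt hp
      have h2 := ih _ (hc ▸ h1) h0 rfl
      have := signVariations_le_eraseLead_succ (P := p)
      omega

open Polynomial in
/-- A generalized Vandermonde determinant with increasing positive nodes and increasing exponents
is positive. Induction on the size: as a polynomial in the last node the determinant has
`r + 1` terms, hence by Descartes' rule of signs no positive roots besides the `r` other nodes, and
its leading coefficient is the determinant of size `r`. -/
theorem det_genVandermonde_pos : ∀ (r : ℕ) (y : Fin r → ℝ) (_ : StrictMono y) (_ : ∀ i, 0 < y i)
    (e : Fin r → ℕ) (_ : StrictMono e), 0 < (Matrix.of fun i j => y i ^ e j).det := by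
  intro r
  induction r with
  | zero => intros; simp
  | succ r ih =>
    intro y hy hpos e he
    -- the cofactors of the last row
    let c : Fin (r + 1) → ℝ := fun j => (-1) ^ ((Fin.last r : ℕ) + (j : ℕ)) *
      (Matrix.of fun i l : Fin r => y i.castSucc ^ e (j.succAbove l)).det
    let p : ℝ[X] := ∑ j, C (c j) * X ^ e j
    -- the nodes, the last one being replaced by `x`
    let z : ℝ → Fin (r + 1) → ℝ := fun x => Fin.snoc (α := fun _ => ℝ) (fun i => y i.castSucc) x
    have zlast : ∀ x, z x (Fin.last r) = x := fun x => Fin.snoc_last (α := fun _ => ℝ) _ _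
    have zcast : ∀ x (i : Fin r), z x i.castSucc = y i.castSucc := fun x i =>
      Fin.snoc_castSucc (α := fun _ => ℝ) _ _ _
    have hev : ∀ x, p.eval x = (Matrix.of fun i j => z x i ^ e j).det := by
      intro x
      rw [Matrix.det_succ_row _ (Fin.last r)]
      simp only [p, eval_finsetSum, eval_mul, eval_C, eval_pow, eval_X]
      refine Finset.sum_congr rfl fun j _ => ?_
      have hs : (Matrix.of fun i l : Fin r => y i.castSucc ^ e (j.succAbove l)) =
        (Matrix.of fun i j => z x i ^ e j).submatrix (Fin.last r).succAbove j.succAbove := by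
        ext i l
        simp [zcast]
      simp only [c, ← hs, Matrix.of_apply, zlast]
      ring
    have hcl : 0 < c (Fin.last r) := by
      have := ih (fun i => y i.castSucc) (fun i j h => hy (Fin.castSucc_lt_castSucc_iff.2 h))
        (fun i => hpos _) (fun j => e j.castSucc)
        (fun i j h => he (Fin.castSucc_lt_castSucc_iff.2 h))
      simpa [c, ← two_mul] using this
    have hcoef : p.coeff (e (Fin.last r)) = c (Fin.last r) := by
      simp only [p, finsetSum_coeff, coeff_C_mul, coeff_X_pow]
      rw [Finset.sum_eq_single (Fin.last r)]
      · simp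
      · intro j _ hj
        rw [if_neg fun h => hj (he.injective h.symm), mul_zero]
      · simp
    have hp0 : p ≠ 0 := fun h => by
      rw [h, coeff_zero] at hcoef
      exact hcl.ne hcoef
    have hdeg : p.natDegree = e (Fin.last r) := by
      refine le_antisymm (natDegree_sum_le_of_forall_le _ _ fun j _ => ?_)
        (le_natDegree_of_ne_zero (hcoef ▸ hcl.ne'))
      exact (natDegree_C_mul_X_pow_le _ _).trans (he.monotone (Fin.le_last j))
    have hlead : p.leadingCoeff = c (Fin.last r) := by rw [leadingCoeff, hdeg, hcoef]
    have hsupp : p.support.card ≤ r + 1 := by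
      have : p.support ⊆ Finset.univ.image e := by
        intro a ha
        rw [mem_support_iff] at ha
        by_contra hne
        refine ha ?_
        simp only [p, finsetSum_coeff, coeff_C_mul, coeff_X_pow]
        refine Finset.sum_eq_zero fun j _ => ?_
        rw [if_neg, mul_zero]
        rintro rfl
        exact hne (Finset.mem_image_of_mem e (Finset.mem_univ j))
      exact (Finset.card_le_card this).trans (Finset.card_image_le.trans (by simp))
    have hroot : ∀ i : Fin r, p.eval (y i.castSucc) = 0 := by
      intro i
      rw [hev]
      refine Matrix.det_zero_of_row_eq (i := i.castSucc) (j := Fin.last r)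
        (Fin.castSucc_lt_last i).ne ?_
      ext j
      simp [zlast, zcast]
    -- a further root would give `r + 1` positive roots
    have hnr : ∀ x, y (Fin.last r) ≤ x → p.eval x ≠ 0 := by
      intro x hx h0
      have hz : StrictMono (z x) := by
        intro i j hij
        obtain ⟨i, rfl⟩ := Fin.exists_castSucc_eq.2 (hij.trans_le (Fin.le_last j)).ne
        induction j using Fin.lastCases with
        | last => simpa [zlast, zcast] using (hy (Fin.castSucc_lt_last i)).trans_le hx
        | cast j =>
          simpa [zcast] using
            hy (Fin.castSucc_lt_castSucc_iff.2 (Fin.castSucc_lt_castSucc_iff.1 hij))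
      have hzp : ∀ i, 0 < (z x) i := by
        intro i
        induction i using Fin.lastCases with
        | last => simpa [zlast] using (hpos _).trans_le hx
        | cast j => simpa [zcast] using hpos _
      have hzr : ∀ i, p.eval ((z x) i) = 0 := by
        intro i
        induction i using Fin.lastCases with
        | last => simpa [zlast] using h0
        | cast j => simpa [zcast] using hroot j
      have hle : (Finset.univ.image
          (z x)).val ≤
          p.roots.filter (0 < ·) := by
        rw [Multiset.le_iff_subset (Finset.nodup _)]
        intro a ha
        obtain ⟨i, -, rfl⟩ := Finset.mem_image.1 (show a ∈ Finset.univ.image (z x) from ha)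
        exact Multiset.mem_filter.2 ⟨(mem_roots hp0).2 (hzr i), hzp i⟩
      have h1 := Multiset.card_le_card hle
      rw [← Multiset.countP_eq_card_filter, Finset.card_val,
        Finset.card_image_of_injective _ hz.injective, Finset.card_univ, Fintype.card_fin] at h1
      have h2 := roots_countP_pos_le_signVariations p
      have h3 := signVariations_lt_card_support hp0
      omega
    have hpose : ∃ x, y (Fin.last r) ≤ x ∧ 0 < p.eval x := by
      rcases Nat.eq_zero_or_pos p.natDegree with h0 | h0
      · refine ⟨_, le_rfl, ?_⟩
        rw [leadingCoeff, h0] at hlead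
        rw [eq_C_of_natDegree_eq_zero h0, eval_C, hlead]
        exact hcl
      · have ht := p.tendsto_atTop_of_leadingCoeff_nonneg (natDegree_pos_iff_degree_pos.1 h0)
          (hlead ▸ hcl.le)
        obtain ⟨x, h1, h2⟩ := ((ht.eventually_gt_atTop 0).and
          (Filter.eventually_ge_atTop (y (Fin.last r)))).exists
        exact ⟨x, h2, h1⟩
    have hfin : 0 < p.eval (y (Fin.last r)) := by
      by_contra hneg
      obtain ⟨x, hx, hx0⟩ := hpose
      obtain ⟨z, hz, hz0⟩ := intermediate_value_Icc hx p.continuous.continuousOn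
        (show (0 : ℝ) ∈ Set.Icc _ _ from ⟨not_lt.1 hneg, hx0.le⟩)
      exact hnr z hz.1 hz0
    rw [hev] at hfin
    convert hfin using 3
    ext i j
    induction i using Fin.lastCases with
    | last => simp [zlast]
    | cast i => simp [zcast]

/-! ### The Gaussian kernel -/

/-- The Gaussian kernel `q ^ ((i - j) ^ 2)`. It is the identity for `q = 0`, and all its minors are
positive for `0 < q < 1`. -/
def gauss (n : ℕ) (q : ℝ) : Matrix (Fin n) (Fin n) ℝ :=
  Matrix.of fun i j => q ^ (((i : ℤ) - (j : ℤ)).natAbs ^ 2)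

theorem gauss_zero (n : ℕ) : gauss n 0 = 1 := by
  ext i j
  rcases eq_or_ne i j with rfl | h
  · simp [gauss]
  · rw [Matrix.one_apply_ne h]
    simp only [gauss, Matrix.of_apply]
    refine zero_pow (pow_ne_zero _ ?_)
    rw [Int.natAbs_ne_zero]
    omega

theorem continuous_gauss (n : ℕ) : Continuous (gauss n) :=
  continuous_matrix fun i j => by
    simp only [gauss, Matrix.of_apply]; fun_prop

theorem gauss_apply_eq {n : ℕ} {q : ℝ} (hq : 0 < q) (i j : Fin n) :
    gauss n q i j = q ^ ((i : ℕ) ^ 2) * ((q⁻¹ ^ (2 * (i : ℕ))) ^ (j : ℕ)) * q ^ ((j : ℕ) ^ 2) := by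
  have h1 : ((((i : ℤ) - (j : ℤ)).natAbs ^ 2 : ℕ) : ℤ) + 2 * i * j = (i : ℤ) ^ 2 + (j : ℤ) ^ 2 := by
    push_cast
    rw [sq_abs]
    ring
  have h2 : ((i : ℤ) - (j : ℤ)).natAbs ^ 2 + 2 * i * j = (i : ℕ) ^ 2 + (j : ℕ) ^ 2 := by
    exact_mod_cast h1
  have h3 : q ^ (2 * (i : ℕ) * j) ≠ 0 := (pow_pos hq _).ne'
  simp only [gauss, Matrix.of_apply]
  rw [← pow_mul, inv_pow]
  field_simp
  rw [← pow_add, ← pow_add, h2]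

theorem gauss_minor_pos {r n : ℕ} {q : ℝ} (hq : 0 < q) (hq1 : q < 1) (I J : Fin r ↪o Fin n) :
    0 < ((gauss n q).submatrix I J).det := by
  have h1 : (gauss n q).submatrix I J =
      Matrix.diagonal (fun i => q ^ ((I i : ℕ) ^ 2)) *
      (Matrix.of fun i j => (q⁻¹ ^ (2 * (I i : ℕ))) ^ (J j : ℕ)) *
      Matrix.diagonal (fun j => q ^ ((J j : ℕ) ^ 2)) := by
    ext i j
    rw [Matrix.mul_diagonal, Matrix.diagonal_mul]
    exact gauss_apply_eq hq _ _
  rw [h1, Matrix.det_mul, Matrix.det_mul, Matrix.det_diagonal, Matrix.det_diagonal]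
  have h2 := det_genVandermonde_pos r (fun i => q⁻¹ ^ (2 * (I i : ℕ))) (fun i j hij => by
      have : (I i : ℕ) < I j := I.strictMono hij
      exact pow_lt_pow_right₀ ((one_lt_inv₀ hq).2 hq1) (by omega))
    (fun i => by positivity) (fun j => (J j : ℕ)) (fun i j hij => J.strictMono hij)
  have h3 : ∀ K : Fin r ↪o Fin n, 0 < ∏ i, q ^ ((K i : ℕ) ^ 2) := fun K =>
    Finset.prod_pos fun i _ => pow_pos hq _
  exact mul_pos (mul_pos (h3 I) h2) (h3 J)

/-! ### Minors, rank and row operations -/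

theorem minor_mul {r n m : ℕ} (C : Matrix (Fin r) (Fin n) ℝ) (A : Matrix (Fin n) (Fin m) ℝ)
    (J : Fin r ↪o Fin m) : ((C * A).submatrix id J).det =
      ∑ I : Fin r ↪o Fin n, (C.submatrix id I).det * (A.submatrix I J).det := by
  have : (C * A).submatrix id J = C * A.submatrix id J := rfl
  rw [this, det_mul_cauchyBinet]
  rfl

theorem minor_rowOp {r n : ℕ} (L : Matrix (Fin r) (Fin r) ℝ) (C : Matrix (Fin r) (Fin n) ℝ)
    (I : Fin r ↪o Fin n) :
    ((L * C).submatrix id I).det = L.det * (C.submatrix id I).det := by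
  rw [← Matrix.det_mul]
  rfl

theorem minor_mul_diagonal {r n : ℕ} (C : Matrix (Fin r) (Fin n) ℝ) (d : Fin n → ℝ)
    (I : Fin r ↪o Fin n) : ((C * Matrix.diagonal d).submatrix id I).det =
      (C.submatrix id I).det * ∏ i, d (I i) := by
  have : (C * Matrix.diagonal d).submatrix id I =
      C.submatrix id I * Matrix.diagonal (fun i => d (I i)) := by
    ext i j
    simp [Matrix.mul_diagonal]
  rw [this, Matrix.det_mul, Matrix.det_diagonal]

theorem rank_of_minor_ne_zero {r n : ℕ} {C : Matrix (Fin r) (Fin n) ℝ} (I : Fin r ↪o Fin n)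
    (h : (C.submatrix id I).det ≠ 0) : C.rank = r := by
  refine le_antisymm (by simpa using C.rank_le_height) ?_
  have h1 := Matrix.rank_of_isUnit (C.submatrix id I)
    ((Matrix.isUnit_iff_isUnit_det _).2 (isUnit_iff_ne_zero.2 h))
  have h2 := Matrix.rank_submatrix_le C id I
  rw [h1, Fintype.card_fin] at h2
  exact h2

/-- A matrix of full row rank has a nonzero maximal minor: the sum of the squares of the minors is
the Gram determinant of the rows. -/
theorem exists_minor_ne_zero {r n : ℕ} {C : Matrix (Fin r) (Fin n) ℝ} (h : C.rank = r) :
    ∃ I : Fin r ↪o Fin n, (C.submatrix id I).det ≠ 0 := by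
  by_contra hne
  push Not at hne
  have h1 : (C * Cᵀ).det = 0 := by
    rw [det_mul_cauchyBinet]
    exact Finset.sum_eq_zero fun I _ => by rw [hne I, zero_mul]
  have h2 : (C * Cᵀ).rank = r := by rw [Matrix.rank_self_mul_transpose, h]
  have h3 : IsUnit (C * Cᵀ) := by
    rw [← Matrix.linearIndependent_rows_iff_isUnit, linearIndependent_iff_card_eq_finrank_span,
      Fintype.card_fin, Set.finrank, ← Matrix.rank_eq_finrank_span_row, h2]
  exact ((Matrix.isUnit_iff_isUnit_det _).1 h3).ne_zero h1

theorem MinorsPos.nonneg {r n : ℕ} {C : Matrix (Fin r) (Fin n) ℝ} (h : MinorsPos C) :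
    MinorsNonneg C := fun I => (h I).le

theorem MinorsNonneg.mul_pos {r n : ℕ} {C : Matrix (Fin r) (Fin n) ℝ}
    {A : Matrix (Fin n) (Fin n) ℝ} (h : MinorsNonneg C) (hr : C.rank = r)
    (hA : ∀ I J : Fin r ↪o Fin n, 0 < (A.submatrix I J).det) : MinorsPos (C * A) := by
  intro J
  rw [minor_mul]
  obtain ⟨I, hI⟩ := exists_minor_ne_zero hr
  exact Finset.sum_pos' (fun I _ => mul_nonneg (h I) (hA I J).le)
    ⟨I, Finset.mem_univ _, _root_.mul_pos ((h I).lt_of_ne' hI) (hA I J)⟩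

theorem MinorsNonneg.mul_gauss {r n : ℕ} {C : Matrix (Fin r) (Fin n) ℝ} (h : MinorsNonneg C)
    (hr : C.rank = r) {q : ℝ} (hq : 0 < q) (hq1 : q < 1) : MinorsPos (C * gauss n q) :=
  h.mul_pos hr (gauss_minor_pos hq hq1)

theorem MinorsPos.rank {r n : ℕ} (hrn : r ≤ n) {C : Matrix (Fin r) (Fin n) ℝ} (h : MinorsPos C) :
    C.rank = r :=
  rank_of_minor_ne_zero (Fin.castLEOrderEmb hrn) (h _).ne'

@[simp]
theorem stack_castAdd {k n : ℕ} (C : Matrix (Fin k) (Fin n) ℝ) (D : Matrix (Fin 2) (Fin n) ℝ)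
    (i : Fin 2) (j : Fin n) : stack C D (Fin.castAdd k i) j = D i j :=
  congrFun (Fin.append_left D C i) j

@[simp]
theorem stack_natAdd {k n : ℕ} (C : Matrix (Fin k) (Fin n) ℝ) (D : Matrix (Fin 2) (Fin n) ℝ)
    (i : Fin k) (j : Fin n) : stack C D (Fin.natAdd 2 i) j = C i j :=
  congrFun (Fin.append_right D C i) j

theorem stack_mul {k n m : ℕ} (C : Matrix (Fin k) (Fin n) ℝ) (D : Matrix (Fin 2) (Fin n) ℝ)
    (A : Matrix (Fin n) (Fin m) ℝ) : stack (C * A) (D * A) = stack C D * A := by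
  ext i j
  refine Fin.addCases (fun i => ?_) (fun i => ?_) i <;>
  simp [Matrix.mul_apply]

/-- The block triangular matrix by which the change of representative
`C ↦ M C`, `D ↦ N D + K C` acts on `C + D`. -/
def rowChange {k : ℕ} (M : Matrix (Fin k) (Fin k) ℝ) (N : Matrix (Fin 2) (Fin 2) ℝ)
    (K : Matrix (Fin 2) (Fin k) ℝ) : Matrix (Fin (2 + k)) (Fin (2 + k)) ℝ :=
  (Matrix.fromBlocks N K 0 M).submatrix finSumFinEquiv.symm finSumFinEquiv.symm

theorem det_rowChange {k : ℕ} (M : Matrix (Fin k) (Fin k) ℝ) (N : Matrix (Fin 2) (Fin 2) ℝ)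
    (K : Matrix (Fin 2) (Fin k) ℝ) : (rowChange M N K).det = N.det * M.det := by
  rw [rowChange, Matrix.det_submatrix_equiv_self, Matrix.det_fromBlocks_zero₂₁]

theorem stack_rowChange {k n : ℕ} (C : Matrix (Fin k) (Fin n) ℝ) (D : Matrix (Fin 2) (Fin n) ℝ)
    (M : Matrix (Fin k) (Fin k) ℝ) (N : Matrix (Fin 2) (Fin 2) ℝ) (K : Matrix (Fin 2) (Fin k) ℝ) :
    stack (M * C) (N * D + K * C) = rowChange M N K * stack C D := by
  ext i j
  refine Fin.addCases (fun i => ?_) (fun i => ?_) i <;>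
  simp [rowChange, Matrix.mul_apply, Fin.sum_univ_add]

theorem minor_stack_rowChange {k n : ℕ} (C : Matrix (Fin k) (Fin n) ℝ)
    (D : Matrix (Fin 2) (Fin n) ℝ) (M : Matrix (Fin k) (Fin k) ℝ) (N : Matrix (Fin 2) (Fin 2) ℝ)
    (K : Matrix (Fin 2) (Fin k) ℝ) (I : Fin (2 + k) ↪o Fin n) :
    ((stack (M * C) (N * D + K * C)).submatrix id I).det =
      N.det * M.det * ((stack C D).submatrix id I).det := by
  rw [stack_rowChange, minor_rowOp, det_rowChange]

/-! ### The positive and nonnegative parts in terms of arbitrary representatives -/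

/-- All maximal minors of `C` have the same weak sign. -/
def SameSign {r n : ℕ} (C : Matrix (Fin r) (Fin n) ℝ) : Prop :=
  ∀ I J : Fin r ↪o Fin n, 0 ≤ (C.submatrix id I).det * (C.submatrix id J).det

/-- All maximal minors of `C` are nonzero and have the same sign. -/
def StrictSameSign {r n : ℕ} (C : Matrix (Fin r) (Fin n) ℝ) : Prop :=
  ∀ I J : Fin r ↪o Fin n, 0 < (C.submatrix id I).det * (C.submatrix id J).det

theorem MinorsNonneg.sameSign {r n : ℕ} {C : Matrix (Fin r) (Fin n) ℝ} (h : MinorsNonneg C) :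
    SameSign C := fun I J => mul_nonneg (h I) (h J)

theorem MinorsPos.strictSameSign {r n : ℕ} {C : Matrix (Fin r) (Fin n) ℝ} (h : MinorsPos C) :
    StrictSameSign C := fun I J => mul_pos (h I) (h J)

theorem SameSign.of_minors {r n : ℕ} {C C' : Matrix (Fin r) (Fin n) ℝ} (h : SameSign C) (a : ℝ)
    (ha : ∀ I : Fin r ↪o Fin n, (C'.submatrix id I).det = a * (C.submatrix id I).det) :
    SameSign C' := by
  intro I J
  rw [ha I, ha J, mul_mul_mul_comm]
  exact mul_nonneg (mul_self_nonneg a) (h I J)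

theorem StrictSameSign.of_minors {r n : ℕ} {C C' : Matrix (Fin r) (Fin n) ℝ}
    (h : StrictSameSign C) {a : ℝ} (h0 : a ≠ 0)
    (ha : ∀ I : Fin r ↪o Fin n, (C'.submatrix id I).det = a * (C.submatrix id I).det) :
    StrictSameSign C' := by
  intro I J
  rw [ha I, ha J, mul_mul_mul_comm]
  exact mul_pos (mul_self_pos.2 h0) (h I J)

theorem StrictSameSign.sameSign {r n : ℕ} {C : Matrix (Fin r) (Fin n) ℝ} (h : StrictSameSign C) :
    SameSign C := fun I J => (h I J).le

/-- The sign shared by the minors can be made `+` by an orthogonal row operation. For `r = 0` there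
is nothing to do, the only minor being `1`. -/
theorem SameSign.exists_orthogonal {r n : ℕ} {C : Matrix (Fin r) (Fin n) ℝ} (h : SameSign C) :
    ∃ S : Matrix (Fin r) (Fin r) ℝ, S * Sᵀ = 1 ∧
      ∀ I : Fin r ↪o Fin n, 0 ≤ S.det * (C.submatrix id I).det := by
  by_cases h0 : MinorsNonneg C
  · exact ⟨1, by simp, fun I => by simpa using h0 I⟩
  · rw [MinorsNonneg] at h0
    push Not at h0
    obtain ⟨I, hI⟩ := h0
    rcases r with _ | r
    · simp at hI
      exact absurd hI (by norm_num)
    · refine ⟨Matrix.diagonal (Function.update 1 0 (-1)), ?_, fun J => ?_⟩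
      · rw [Matrix.diagonal_transpose, Matrix.diagonal_mul_diagonal, ← Matrix.diagonal_one]
        congr 1
        ext i
        rcases eq_or_ne i 0 with rfl | hi <;> simp [*]
      · have : (C.submatrix id J).det ≤ 0 := by
          by_contra hJ
          exact (h I J).not_gt (mul_neg_of_neg_of_pos hI (not_le.1 hJ))
        rw [Matrix.det_diagonal, Fin.prod_univ_succ]
        simpa [Function.update_of_ne] using this

theorem det_ne_zero_of_mul_transpose_eq_one {r : ℕ} {S : Matrix (Fin r) (Fin r) ℝ}
    (h : S * Sᵀ = 1) : S.det ≠ 0 := by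
  intro h0
  have := congrArg Matrix.det h
  simp [h0] at this

/-- A representative whose minors have constant signs becomes nonnegative after orthogonal
operations on the rows of `C` and on those of `D`. -/
theorem exists_nonneg_of_sameSign {k n : ℕ} {P : FullRankPair k n} (hC : SameSign P.1.1)
    (hS : SameSign (stack P.1.1 P.1.2)) :
    ∃ (Q : FullRankPair k n) (M : Matrix (Fin k) (Fin k) ℝ) (N : Matrix (Fin 2) (Fin 2) ℝ),
      M * Mᵀ = 1 ∧ N * Nᵀ = 1 ∧ Q.1.1 = M * P.1.1 ∧ Q.1.2 = N * P.1.2 ∧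
      MinorsNonneg Q.1.1 ∧ MinorsNonneg (stack Q.1.1 Q.1.2) ∧ Flag.proj P = Flag.proj Q := by
  obtain ⟨M, hM, hMC⟩ := hC.exists_orthogonal
  have hst : ∀ (N : Matrix (Fin 2) (Fin 2) ℝ) (I : Fin (2 + k) ↪o Fin n),
      ((stack (M * P.1.1) (N * P.1.2)).submatrix id I).det =
        N.det * M.det * ((stack P.1.1 P.1.2).submatrix id I).det := by
    intro N I
    have := minor_stack_rowChange P.1.1 P.1.2 M N 0 I
    rwa [Matrix.zero_mul, add_zero] at this
  have hN : ∃ N : Matrix (Fin 2) (Fin 2) ℝ, N * Nᵀ = 1 ∧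
      MinorsNonneg (stack (M * P.1.1) (N * P.1.2)) := by
    by_cases h0 : MinorsNonneg (stack (M * P.1.1) ((1 : Matrix (Fin 2) (Fin 2) ℝ) * P.1.2))
    · exact ⟨1, by simp, h0⟩
    · rw [MinorsNonneg] at h0
      push Not at h0
      obtain ⟨I, hI⟩ := h0
      have h1 : SameSign (stack (M * P.1.1) ((1 : Matrix (Fin 2) (Fin 2) ℝ) * P.1.2)) :=
        hS.of_minors _ (hst 1)
      refine ⟨!![-1, 0; 0, 1], by ext i j; fin_cases i <;> fin_cases j <;>
        simp [Matrix.mul_apply], fun J => ?_⟩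
      have h2 : ((stack (M * P.1.1) ((1 : Matrix (Fin 2) (Fin 2) ℝ) * P.1.2)).submatrix id J).det
          ≤ 0 := by
        by_contra hJ
        exact (h1 I J).not_gt (mul_neg_of_neg_of_pos hI (not_le.1 hJ))
      rw [hst] at h2 ⊢
      simp only [Matrix.det_one, Matrix.det_fin_two_of] at h2 ⊢
      linarith
  obtain ⟨N, hN, hNS⟩ := hN
  have hMu := isUnit_iff_ne_zero.2 (det_ne_zero_of_mul_transpose_eq_one hM)
  have hNu := isUnit_iff_ne_zero.2 (det_ne_zero_of_mul_transpose_eq_one hN)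
  have hr : (M * P.1.1).rank = k ∧ (stack (M * P.1.1) (N * P.1.2)).rank = k + 2 := by
    constructor
    · rw [Matrix.rank_mul_eq_right_of_isUnit_det _ _ hMu, P.2.1]
    · have := stack_rowChange P.1.1 P.1.2 M N 0
      rw [Matrix.zero_mul, add_zero] at this
      rw [this, Matrix.rank_mul_eq_right_of_isUnit_det _ _ (by
        rw [det_rowChange]; exact hNu.mul hMu), P.2.2]
  refine ⟨⟨(M * P.1.1, N * P.1.2), hr⟩, M, N, hM, hN, rfl, rfl, fun I => ?_, hNS, ?_⟩
  · rw [minor_rowOp]; exact hMC I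
  · exact proj_eq_of (M := M) (N := N) (K := 0) rfl (by simp)

/-- Another representative multiplies all minors of `C` by one factor, and those of `C + D` by
another, so the products of two minors keep their signs. -/
theorem proj_mem_nonnegFlag {k n : ℕ} (P : FullRankPair k n) :
    Flag.proj P ∈ nonnegFlag k n ↔ SameSign P.1.1 ∧ SameSign (stack P.1.1 P.1.2) := by
  constructor
  · rintro ⟨Q, hC, hS, hQ⟩
    obtain ⟨M, N, K, h1, h2⟩ := exists_of_proj_eq hQ
    rw [h2, h1]
    exact ⟨hC.sameSign.of_minors _ (minor_rowOp M _),
      hS.sameSign.of_minors _ (minor_stack_rowChange _ _ M N K)⟩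
  · rintro ⟨hC, hS⟩
    obtain ⟨Q, M, N, -, -, -, -, h1, h2, h3⟩ := exists_nonneg_of_sameSign hC hS
    exact ⟨Q, h1, h2, h3.symm⟩

theorem proj_mem_posFlag {k n : ℕ} (P : FullRankPair k n) :
    Flag.proj P ∈ posFlag k n ↔ StrictSameSign P.1.1 ∧ StrictSameSign (stack P.1.1 P.1.2) := by
  constructor
  · rintro ⟨Q, hC, hS, hQ⟩
    obtain ⟨M, N, K, h1, h2⟩ := exists_of_proj_eq hQ
    have hrC := P.2.1
    have hrS := P.2.2
    rw [h2, h1] at hrS ⊢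
    rw [h1] at hrC
    obtain ⟨I, hI⟩ := exists_minor_ne_zero hrC
    obtain ⟨J, hJ⟩ := exists_minor_ne_zero (hrS.trans (add_comm k 2))
    rw [minor_rowOp] at hI
    rw [minor_stack_rowChange] at hJ
    exact ⟨hC.strictSameSign.of_minors (left_ne_zero_of_mul hI) (minor_rowOp M _),
      hS.strictSameSign.of_minors (left_ne_zero_of_mul hJ) (minor_stack_rowChange _ _ M N K)⟩
  · rintro ⟨hC, hS⟩
    obtain ⟨Q, M, N, hM, hN, e1, e2, h1, h2, h3⟩ :=
      exists_nonneg_of_sameSign hC.sameSign hS.sameSign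
    have hM0 := det_ne_zero_of_mul_transpose_eq_one hM
    have hN0 := det_ne_zero_of_mul_transpose_eq_one hN
    refine ⟨Q, fun I => (h1 I).lt_of_ne' ?_, fun I => (h2 I).lt_of_ne' ?_, h3.symm⟩
    · rw [e1, minor_rowOp]
      exact mul_ne_zero hM0 (left_ne_zero_of_mul (hC I I).ne')
    · have e := minor_stack_rowChange P.1.1 P.1.2 M N 0 I
      rw [Matrix.zero_mul, add_zero, ← e1, ← e2] at e
      rw [e]
      exact mul_ne_zero (mul_ne_zero hN0 hM0) (left_ne_zero_of_mul (hS I I).ne')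

theorem continuous_stack {α : Type*} [TopologicalSpace α] {k n : ℕ}
    {f : α → Matrix (Fin k) (Fin n) ℝ} {g : α → Matrix (Fin 2) (Fin n) ℝ} (hf : Continuous f)
    (hg : Continuous g) : Continuous fun a => stack (f a) (g a) := by
  refine continuous_matrix fun i j => ?_
  refine Fin.addCases (fun i => ?_) (fun i => ?_) i
  · simpa using hg.matrix_elem i j
  · simpa using hf.matrix_elem i j

theorem continuous_minor {α : Type*} [TopologicalSpace α] {r n : ℕ}
    {f : α → Matrix (Fin r) (Fin n) ℝ} (hf : Continuous f) (I : Fin r ↪o Fin n) :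
    Continuous fun a => ((f a).submatrix id I).det :=
  (hf.matrix_submatrix id I).matrix_det

theorem continuous_pairC {k n : ℕ} : Continuous fun P : FullRankPair k n => P.1.1 :=
  continuous_fst.comp continuous_subtype_val

theorem continuous_pairStack {k n : ℕ} :
    Continuous fun P : FullRankPair k n => stack P.1.1 P.1.2 :=
  continuous_stack continuous_pairC (continuous_snd.comp continuous_subtype_val)

theorem isClosed_nonnegFlag (k n : ℕ) : IsClosed (nonnegFlag k n) := by
  rw [← (isQuotientMap_proj k n).isClosed_preimage]
  have : Flag.proj ⁻¹' nonnegFlag k n =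
      {P | SameSign P.1.1 ∧ SameSign (stack P.1.1 P.1.2)} := Set.ext proj_mem_nonnegFlag
  rw [this]
  simp only [SameSign, Set.ofPred_and, Set.ofPred_forall]
  refine IsClosed.inter ?_ ?_ <;>
    refine isClosed_iInter fun I => isClosed_iInter fun J => isClosed_le continuous_const ?_
  · exact (continuous_minor continuous_pairC I).mul (continuous_minor continuous_pairC J)
  · exact (continuous_minor continuous_pairStack I).mul (continuous_minor continuous_pairStack J)

theorem isOpen_posFlag (k n : ℕ) : IsOpen (posFlag k n) := by
  rw [← (isQuotientMap_proj k n).isOpen_preimage]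
  have : Flag.proj ⁻¹' posFlag k n =
      {P | StrictSameSign P.1.1 ∧ StrictSameSign (stack P.1.1 P.1.2)} := Set.ext proj_mem_posFlag
  rw [this]
  simp only [StrictSameSign, Set.ofPred_and, Set.ofPred_forall]
  refine IsOpen.inter ?_ ?_ <;>
    refine isOpen_iInter_of_finite fun I => isOpen_iInter_of_finite fun J =>
      isOpen_lt continuous_const ?_
  · exact (continuous_minor continuous_pairC I).mul (continuous_minor continuous_pairC J)
  · exact (continuous_minor continuous_pairStack I).mul (continuous_minor continuous_pairStack J)

/-! ### Normal forms and their contraction -/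

/-- The middle `k` columns of a matrix with `2 + k + l` columns. -/
def midCols (k l : ℕ) : Fin k ↪o Fin (2 + k + l) :=
  (Fin.natAddOrderEmb 2).trans (Fin.castAddOrderEmb l)

/-- The first `2 + k` columns of a matrix with `2 + k + l` columns. -/
def leadCols (k l : ℕ) : Fin (2 + k) ↪o Fin (2 + k + l) := Fin.castAddOrderEmb l

/-- Column weights `t, 1, t ^ 2` on the blocks of sizes `2, k, l`. -/
def shrinkC (k l : ℕ) (t : ℝ) : Fin (2 + k + l) → ℝ :=
  Fin.append (Fin.append (fun _ : Fin 2 => t) (fun _ : Fin k => 1)) (fun _ : Fin l => t ^ 2)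

/-- Column weights `1, 1, t` on the blocks of sizes `2, k, l`. -/
def shrinkD (k l : ℕ) (t : ℝ) : Fin (2 + k + l) → ℝ :=
  Fin.append (fun _ : Fin (2 + k) => 1) (fun _ : Fin l => t)

theorem shrinkC_nonneg {k l : ℕ} {t : ℝ} (ht : 0 ≤ t) (j : Fin (2 + k + l)) :
    0 ≤ shrinkC k l t j := by
  refine Fin.addCases (fun j => Fin.addCases (fun j => ?_) (fun j => ?_) j) (fun j => ?_) j <;>
    simp [shrinkC, ht]

theorem shrinkC_one (k l : ℕ) : shrinkC k l 1 = 1 := by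
  funext j
  refine Fin.addCases (fun j => Fin.addCases (fun j => ?_) (fun j => ?_) j) (fun j => ?_) j <;>
    simp [shrinkC]

theorem shrinkD_one (k l : ℕ) : shrinkD k l 1 = 1 := by
  funext j
  refine Fin.addCases (fun j => ?_) (fun j => ?_) j <;> simp [shrinkD]

theorem continuous_shrinkC (k l : ℕ) : Continuous (shrinkC k l) := by
  refine continuous_pi fun j => ?_
  refine Fin.addCases (fun j => Fin.addCases (fun j => ?_) (fun j => ?_) j) (fun j => ?_) j <;>
    simp only [shrinkC, Fin.append_left, Fin.append_right] <;> fun_prop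

theorem continuous_shrinkD (k l : ℕ) : Continuous (shrinkD k l) := by
  refine continuous_pi fun j => ?_
  refine Fin.addCases (fun j => ?_) (fun j => ?_) j <;>
    simp only [shrinkD, Fin.append_left, Fin.append_right] <;> fun_prop

/-- The representative `(X₁ | 1 | X₂)` of the row span of `C`. -/
noncomputable def normC {k l : ℕ} (C : Matrix (Fin k) (Fin (2 + k + l)) ℝ) :
    Matrix (Fin k) (Fin (2 + k + l)) ℝ :=
  (C.submatrix id (midCols k l))⁻¹ * C

/-- The inverse of the leading block of `C + D`. -/
noncomputable def leadInv {k l : ℕ} (C : Matrix (Fin k) (Fin (2 + k + l)) ℝ)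
    (D : Matrix (Fin 2) (Fin (2 + k + l)) ℝ) : Matrix (Fin (2 + k)) (Fin (2 + k)) ℝ :=
  ((stack C D).submatrix id (leadCols k l))⁻¹

/-- The matrix `(1 | 0 | Y)` with rows in the row span of `C + D`. -/
noncomputable def normD {k l : ℕ} (C : Matrix (Fin k) (Fin (2 + k + l)) ℝ)
    (D : Matrix (Fin 2) (Fin (2 + k + l)) ℝ) : Matrix (Fin 2) (Fin (2 + k + l)) ℝ :=
  (leadInv C D).submatrix (Fin.castAdd k) (Fin.castAdd k) * D +
    (leadInv C D).submatrix (Fin.castAdd k) (Fin.natAdd 2) * C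

section Contraction

variable {k l : ℕ} {C : Matrix (Fin k) (Fin (2 + k + l)) ℝ}
  {D : Matrix (Fin 2) (Fin (2 + k + l)) ℝ}

theorem normC_mid (hC : MinorsPos C) : (normC C).submatrix id (midCols k l) = 1 := by
  have : (normC C).submatrix id (midCols k l) =
      (C.submatrix id (midCols k l))⁻¹ * C.submatrix id (midCols k l) := rfl
  rw [this, Matrix.nonsing_inv_mul _ (isUnit_iff_ne_zero.2 (hC _).ne')]

theorem normC_apply_mid (hC : MinorsPos C) (i j : Fin k) :
    normC C i (Fin.castAdd l (Fin.natAdd 2 j)) = (1 : Matrix (Fin k) (Fin k) ℝ) i j :=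
  congrFun (congrFun (normC_mid hC) i) j

theorem normD_apply_lead (hS : MinorsPos (stack C D)) (i : Fin 2) (j : Fin (2 + k)) :
    normD C D i (Fin.castAdd l j) =
      (1 : Matrix (Fin (2 + k)) (Fin (2 + k)) ℝ) (Fin.castAdd k i) j := by
  have h1 : normD C D i (Fin.castAdd l j) =
      (leadInv C D * (stack C D).submatrix id (leadCols k l)) (Fin.castAdd k i) j := by
    simp [normD, Matrix.mul_apply, Fin.sum_univ_add]
    rfl
  rw [h1, leadInv, Matrix.nonsing_inv_mul _ (isUnit_iff_ne_zero.2 (hS _).ne')]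

theorem normD_apply_left (hS : MinorsPos (stack C D)) (i j : Fin 2) :
    normD C D i (Fin.castAdd l (Fin.castAdd k j)) = (1 : Matrix (Fin 2) (Fin 2) ℝ) i j := by
  rw [normD_apply_lead hS]
  simp [Matrix.one_apply]

theorem normD_apply_mid (hS : MinorsPos (stack C D)) (i : Fin 2) (j : Fin k) :
    normD C D i (Fin.castAdd l (Fin.natAdd 2 j)) = 0 := by
  rw [normD_apply_lead hS, Matrix.one_apply_ne]
  intro h
  have := congrArg Fin.val h
  simp at this
  omega

/-- The path of matrices from `normC C` (at `t = 1`) to `(0 | 1 | 0)` (at `t = 0`). -/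
noncomputable def contractC (C : Matrix (Fin k) (Fin (2 + k + l)) ℝ) (t : ℝ) :
    Matrix (Fin k) (Fin (2 + k + l)) ℝ :=
  normC C * Matrix.diagonal (shrinkC k l t)

/-- The path of matrices from `normD C D` (at `t = 1`) to `(1 | 0 | 0)` (at `t = 0`). -/
noncomputable def contractD (C : Matrix (Fin k) (Fin (2 + k + l)) ℝ)
    (D : Matrix (Fin 2) (Fin (2 + k + l)) ℝ) (t : ℝ) : Matrix (Fin 2) (Fin (2 + k + l)) ℝ :=
  normD C D * Matrix.diagonal (shrinkD k l t)

theorem contractC_one : contractC C 1 = normC C := by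
  rw [contractC, shrinkC_one]
  simp

theorem contractD_one : contractD C D 1 = normD C D := by
  rw [contractD, shrinkD_one]
  simp

theorem continuous_contractC : Continuous (contractC C) :=
  continuous_const.matrix_mul (continuous_shrinkC k l).matrix_diagonal

theorem continuous_contractD : Continuous (contractD C D) :=
  continuous_const.matrix_mul (continuous_shrinkD k l).matrix_diagonal

theorem contractC_zero (hC : MinorsPos C) :
    contractC C 0 = (1 : Matrix (Fin (2 + k + l)) (Fin (2 + k + l)) ℝ).submatrix
      (midCols k l) id := by
  ext i j
  have h : midCols k l i = Fin.castAdd l (Fin.natAdd 2 i) := rfl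
  rw [contractC, Matrix.mul_diagonal, Matrix.submatrix_apply, h]
  refine Fin.addCases (fun j => ?_) (fun j => ?_) j
  · refine Fin.addCases (fun j => ?_) (fun j => ?_) j
    · rw [Matrix.one_apply_ne]
      · simp [shrinkC]
      · refine fun h => ?_
        have := congrArg Fin.val h
        simp at this
        omega
    · rw [normC_apply_mid hC]
      simp [shrinkC, Matrix.one_apply]
  · rw [Matrix.one_apply_ne]
    · simp [shrinkC]
    · refine fun h => ?_
      have := congrArg Fin.val h
      simp at this
      omega

theorem contractD_zero (hS : MinorsPos (stack C D)) :
    contractD C D 0 = (1 : Matrix (Fin (2 + k + l)) (Fin (2 + k + l)) ℝ).submatrix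
      (fun i => Fin.castAdd l (Fin.castAdd k i)) id := by
  ext i j
  rw [contractD, Matrix.mul_diagonal, Matrix.submatrix_apply]
  refine Fin.addCases (fun j => ?_) (fun j => ?_) j
  · simp [shrinkD, normD_apply_lead hS, Matrix.one_apply]
  · simp [shrinkD, Matrix.one_apply, Fin.ext_iff]
    omega

theorem contractC_mid (hC : MinorsPos C) (t : ℝ) :
    (contractC C t).submatrix id (midCols k l) = 1 := by
  ext i j
  show contractC C t i (Fin.castAdd l (Fin.natAdd 2 j)) = _
  rw [contractC, Matrix.mul_diagonal, normC_apply_mid hC]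
  simp [shrinkC]

theorem contractC_rank (hC : MinorsPos C) (t : ℝ) : (contractC C t).rank = k :=
  rank_of_minor_ne_zero (midCols k l) (by rw [contractC_mid hC]; simp)

theorem contractC_nonneg (hC : MinorsPos C) {t : ℝ} (ht : 0 ≤ t) :
    MinorsNonneg (contractC C t) := by
  intro I
  have h1 := hC (midCols k l)
  rw [contractC, minor_mul_diagonal, normC, minor_rowOp, Matrix.det_nonsing_inv,
    Ring.inverse_eq_inv']
  exact mul_nonneg (mul_nonneg (inv_nonneg.2 h1.le) (hC I).le)
    (Finset.prod_nonneg fun i _ => shrinkC_nonneg ht _)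

theorem det_eq_one_of_blocks {A : Matrix (Fin (2 + k)) (Fin (2 + k)) ℝ}
    (h1 : ∀ i j, A (Fin.castAdd k i) (Fin.castAdd k j) = (1 : Matrix (Fin 2) (Fin 2) ℝ) i j)
    (h2 : ∀ i j, A (Fin.castAdd k i) (Fin.natAdd 2 j) = 0)
    (h3 : ∀ i j, A (Fin.natAdd 2 i) (Fin.natAdd 2 j) = (1 : Matrix (Fin k) (Fin k) ℝ) i j) :
    A.det = 1 := by
  have : A.submatrix finSumFinEquiv finSumFinEquiv = Matrix.fromBlocks 1 0
      (A.submatrix (Fin.natAdd 2) (Fin.castAdd k)) 1 := by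
    ext (i | i) (j | j) <;> simp [h1, h2, h3]
  rw [← Matrix.det_submatrix_equiv_self finSumFinEquiv A, this, Matrix.det_fromBlocks_zero₁₂]
  simp

theorem contract_lead (hC : MinorsPos C) (hS : MinorsPos (stack C D)) (t : ℝ) :
    ((stack (contractC C t) (contractD C D t)).submatrix id (leadCols k l)).det = 1 := by
  refine det_eq_one_of_blocks (fun i j => ?_) (fun i j => ?_) (fun i j => ?_) <;>
    rw [Matrix.submatrix_apply] <;>
    simp only [id, stack_castAdd, stack_natAdd]
  · show contractD C D t i (Fin.castAdd l (Fin.castAdd k j)) = _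
    rw [contractD, Matrix.mul_diagonal, normD_apply_left hS]
    simp [shrinkD]
  · show contractD C D t i (Fin.castAdd l (Fin.natAdd 2 j)) = _
    rw [contractD, Matrix.mul_diagonal, normD_apply_mid hS, zero_mul]
  · exact congrFun (congrFun (contractC_mid hC t) i) j

theorem contract_stack_rank (hC : MinorsPos C) (hS : MinorsPos (stack C D)) (t : ℝ) :
    (stack (contractC C t) (contractD C D t)).rank = k + 2 := by
  rw [rank_of_minor_ne_zero (leadCols k l) (by rw [contract_lead hC hS]; exact one_ne_zero),
    add_comm]

/-- Multiplying the row block `D` by `t` makes its weights agree with those of `C`, because the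
middle block of `normD C D` vanishes. -/
theorem smul_contractD (hS : MinorsPos (stack C D)) (t : ℝ) :
    t • contractD C D t = normD C D * Matrix.diagonal (shrinkC k l t) := by
  ext i j
  rw [Matrix.smul_apply, contractD, Matrix.mul_diagonal, Matrix.mul_diagonal]
  refine Fin.addCases (fun j => Fin.addCases (fun j => ?_) (fun j => ?_) j) (fun j => ?_) j <;>
    simp [shrinkC, shrinkD, normD_apply_mid hS] <;> ring

theorem norm_stack_nonneg (hC : MinorsPos C) (hS : MinorsPos (stack C D)) :
    MinorsNonneg (stack (normC C) (normD C D)) := by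
  have h1 := contract_lead hC hS 1
  rw [contractC_one, contractD_one] at h1
  unfold normC normD at h1 ⊢
  intro I
  rw [minor_stack_rowChange] at h1 ⊢
  -- the two operations have positive determinant, since both leading minors are positive
  refine mul_nonneg (pos_of_mul_pos_left (h1 ▸ one_pos) (hS _).le).le (hS I).le

theorem contract_stack_nonneg (hC : MinorsPos C) (hS : MinorsPos (stack C D)) {t : ℝ}
    (ht : 0 ≤ t) : MinorsNonneg (stack (contractC C t) (contractD C D t)) := by
  intro I
  have hcont : Continuous fun t : ℝ =>
      ((stack (contractC C t) (contractD C D t)).submatrix id I).det :=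
    continuous_minor (continuous_stack continuous_contractC continuous_contractD) I
  have hpos : ∀ t ∈ Set.Ioi (0 : ℝ),
      0 ≤ ((stack (contractC C t) (contractD C D t)).submatrix id I).det := by
    intro t ht
    have h1 : stack (contractC C t) (t • contractD C D t) =
        stack (normC C) (normD C D) * Matrix.diagonal (shrinkC k l t) := by
      rw [smul_contractD hS, contractC, stack_mul]
    have h2 := minor_stack_rowChange (contractC C t) (contractD C D t) 1
      (t • (1 : Matrix (Fin 2) (Fin 2) ℝ)) 0 I
    rw [Matrix.one_mul, Matrix.zero_mul, add_zero, Matrix.smul_mul, Matrix.one_mul, h1,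
      minor_mul_diagonal, Matrix.det_one, mul_one, Matrix.det_smul, Matrix.det_one, mul_one,
      Fintype.card_fin] at h2
    have h3 : 0 < t ^ 2 := pow_pos ht 2
    refine nonneg_of_mul_nonneg_right (h2 ▸ ?_) h3
    exact mul_nonneg (norm_stack_nonneg hC hS I)
      (Finset.prod_nonneg fun i _ => shrinkC_nonneg (le_of_lt ht) _)
  -- the minors at `t = 0` are limits of those at `t > 0`
  have hcl : IsClosed
      {t : ℝ | 0 ≤ ((stack (contractC C t) (contractD C D t)).submatrix id I).det} :=
    isClosed_le continuous_const hcont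
  have := closure_minimal (show Set.Ioi (0 : ℝ) ⊆ _ from hpos) hcl
  rw [closure_Ioi] at this
  exact this ht

end Contraction

/-! ### Paths to a base point -/

/-- A full rank matrix with nonnegative maximal minors. -/
abbrev NonnegMat (k n : ℕ) : Type := {C : FullRankMat k n // MinorsNonneg C.1}

/-- A full rank loopy pair `C ⋮ D` such that `C` and `C + D` have nonnegative maximal minors. -/
abbrev NonnegPair (k n : ℕ) : Type :=
  {P : FullRankPair k n // MinorsNonneg P.1.1 ∧ MinorsNonneg (stack P.1.1 P.1.2)}

/-- All maximal minors of `C` and `C + D` are positive. -/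
def NonnegPair.IsPos {k n : ℕ} (P : NonnegPair k n) : Prop :=
  MinorsPos P.1.1.1 ∧ MinorsPos (stack P.1.1.1 P.1.1.2)

/-- A path of matrices from the identity to the square of the Gaussian kernel for `q = 1 / 2`. -/
noncomputable def heat (n : ℕ) (t : ℝ) : Matrix (Fin n) (Fin n) ℝ :=
  gauss n (t / 2) * gauss n (t / 2)

theorem heat_zero (n : ℕ) : heat n 0 = 1 := by simp [heat, gauss_zero]

theorem continuous_heat (n : ℕ) : Continuous (heat n) :=
  have h : Continuous fun t : ℝ => gauss n (t / 2) :=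
    (continuous_gauss n).comp (continuous_id.div_const 2)
  h.matrix_mul h

section Heat

variable {r n : ℕ} {C : Matrix (Fin r) (Fin n) ℝ}

theorem MinorsNonneg.mul_heat_pos (hrn : r ≤ n) (h : MinorsNonneg C) (hr : C.rank = r) {t : ℝ}
    (h0 : 0 < t) (h1 : t ≤ 1) : MinorsPos (C * heat n t) := by
  rw [heat, ← Matrix.mul_assoc]
  have := h.mul_gauss hr (q := t / 2) (by linarith) (by linarith)
  exact this.nonneg.mul_gauss (this.rank hrn) (by linarith) (by linarith)

theorem MinorsNonneg.mul_heat (hrn : r ≤ n) (h : MinorsNonneg C) (hr : C.rank = r) {t : ℝ}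
    (h0 : 0 ≤ t) (h1 : t ≤ 1) : MinorsNonneg (C * heat n t) ∧ (C * heat n t).rank = r := by
  rcases h0.eq_or_lt with rfl | h0
  · simpa [heat_zero] using ⟨h, hr⟩
  · have := h.mul_heat_pos hrn hr h0 h1
    exact ⟨this.nonneg, this.rank hrn⟩

end Heat

theorem rank_stack_pair {k n : ℕ} (P : FullRankPair k n) : (stack P.1.1 P.1.2).rank = 2 + k :=
  P.2.2.trans (add_comm k 2)

/-- Every nonnegative representative is joined to a positive one by a path `γ₁` that is positive
except at its start, and an equivalent representative is joined by a path `γ₂` of positive ones to a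
base point that does not depend on the representative. -/
theorem exists_paths_pair (k l : ℕ) : ∃ B : NonnegPair k (2 + k + l), B.IsPos ∧
    ∀ P : NonnegPair k (2 + k + l), ∃ γ₁ γ₂ : unitInterval → NonnegPair k (2 + k + l),
      Continuous γ₁ ∧ Continuous γ₂ ∧ γ₁ 0 = P ∧ (∀ t, t ≠ 0 → (γ₁ t).IsPos) ∧
      (∀ t, (γ₂ t).IsPos) ∧ γ₂ 0 = B ∧ Flag.proj (γ₁ 1).1 = Flag.proj (γ₂ 1).1 := by
  have hk : k ≤ 2 + k + l := by omega
  have hk2 : 2 + k ≤ 2 + k + l := by omega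
  set n := 2 + k + l with hn
  have hq : (0 : ℝ) < 1 / 2 := by norm_num
  have hq1 : (1 / 2 : ℝ) < 1 := by norm_num
  set G := gauss n (1 / 2) with hG
  -- the second path, for a given positive pair
  have key : ∀ (C : Matrix (Fin k) (Fin n) ℝ) (D : Matrix (Fin 2) (Fin n) ℝ) (_ : MinorsPos C)
      (_ : MinorsPos (stack C D)), ∃ γ : unitInterval → NonnegPair k n, Continuous γ ∧
        (∀ t, (γ t).IsPos) ∧
        ∀ t : unitInterval, (γ t).1.1 = (contractC C t * G, contractD C D t * G) := by
    intro C D hC hS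
    have h1 : ∀ t : unitInterval, MinorsPos (contractC C t * G) := fun t =>
      (contractC_nonneg hC t.2.1).mul_gauss (contractC_rank hC t) hq hq1
    have h2 : ∀ t : unitInterval,
        MinorsPos (stack (contractC C t * G) (contractD C D t * G)) := fun t => by
      rw [stack_mul]
      exact (contract_stack_nonneg hC hS t.2.1).mul_gauss
        ((contract_stack_rank hC hS t).trans (add_comm k 2)) hq hq1
    refine ⟨fun t => ⟨⟨(contractC C t * G, contractD C D t * G), (h1 t).rank hk,
      ((h2 t).rank hk2).trans (add_comm 2 k)⟩, (h1 t).nonneg, (h2 t).nonneg⟩, ?_,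
      fun t => ⟨h1 t, h2 t⟩, fun t => rfl⟩
    refine Continuous.subtype_mk (Continuous.subtype_mk (Continuous.prodMk ?_ ?_) _) _
    · exact (continuous_contractC.comp continuous_subtype_val).matrix_mul continuous_const
    · exact (continuous_contractD.comp continuous_subtype_val).matrix_mul continuous_const
  -- the first path
  have key1 : ∀ P : NonnegPair k n, ∃ γ : unitInterval → NonnegPair k n, Continuous γ ∧
      (∀ t, t ≠ 0 → (γ t).IsPos) ∧
      ∀ t : unitInterval, (γ t).1.1 = (P.1.1.1 * heat n t, P.1.1.2 * heat n t) := by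
    intro P
    have h1 := fun t : unitInterval => P.2.1.mul_heat hk P.1.2.1 t.2.1 t.2.2
    have h2 := fun t : unitInterval => P.2.2.mul_heat hk2 (rank_stack_pair P.1) t.2.1 t.2.2
    refine ⟨fun t => ⟨⟨(P.1.1.1 * heat n t, P.1.1.2 * heat n t), (h1 t).2, ?_⟩, (h1 t).1, ?_⟩,
      ?_, fun t ht => ⟨?_, ?_⟩, fun t => rfl⟩
    · rw [stack_mul, (h2 t).2, add_comm]
    · rw [stack_mul]; exact (h2 t).1
    · have hh : Continuous fun t : unitInterval => heat n t :=
        (continuous_heat n).comp continuous_subtype_val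
      exact Continuous.subtype_mk (Continuous.subtype_mk (Continuous.prodMk
        (continuous_const.matrix_mul hh) (continuous_const.matrix_mul hh)) _) _
    · exact P.2.1.mul_heat_pos hk P.1.2.1 (unitInterval.pos_iff_ne_zero.2 ht) t.2.2
    · show MinorsPos (stack (P.1.1.1 * heat n t) (P.1.1.2 * heat n t))
      rw [stack_mul]
      exact P.2.2.mul_heat_pos hk2 (rank_stack_pair P.1) (unitInterval.pos_iff_ne_zero.2 ht) t.2.2
  have hB1 : MinorsPos (G.submatrix (midCols k l) id) := fun I => gauss_minor_pos hq hq1 _ _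
  have hBs : stack (G.submatrix (midCols k l) id)
      (G.submatrix (fun i => Fin.castAdd l (Fin.castAdd k i)) id) =
      G.submatrix (leadCols k l) id := by
    ext i j
    refine Fin.addCases (fun i => ?_) (fun i => ?_) i
    · rw [stack_castAdd]; rfl
    · rw [stack_natAdd]; rfl
  have hB2 : MinorsPos (stack (G.submatrix (midCols k l) id)
      (G.submatrix (fun i => Fin.castAdd l (Fin.castAdd k i)) id)) := by
    rw [hBs]
    exact fun I => gauss_minor_pos hq hq1 _ _
  refine ⟨⟨⟨(G.submatrix (midCols k l) id,
    G.submatrix (fun i => Fin.castAdd l (Fin.castAdd k i)) id),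
    hB1.rank hk, (hB2.rank hk2).trans (add_comm 2 k)⟩, hB1.nonneg, hB2.nonneg⟩, ⟨hB1, hB2⟩,
    fun P => ?_⟩
  have hC : MinorsPos (P.1.1.1 * G) := P.2.1.mul_gauss P.1.2.1 hq hq1
  have hS : MinorsPos (stack (P.1.1.1 * G) (P.1.1.2 * G)) := by
    rw [stack_mul]
    exact P.2.2.mul_gauss (rank_stack_pair P.1) hq hq1
  obtain ⟨γ₁, hγ₁, hp₁, e₁⟩ := key1 P
  obtain ⟨γ₂, hγ₂, hp₂, e₂⟩ := key _ _ hC hS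
  refine ⟨γ₁, γ₂, hγ₁, hγ₂, Subtype.ext (Subtype.ext ?_), hp₁, hp₂,
    Subtype.ext (Subtype.ext ?_), ?_⟩
  · rw [e₁]
    simp [heat_zero]
  · rw [e₂]
    simp only [Set.Icc.coe_zero, contractC_zero hC, contractD_zero hS]
    refine Prod.ext ?_ ?_ <;> ext i j <;> simp [Matrix.mul_apply, Matrix.one_apply]
  · have e₁' := e₁ 1
    have e₂' := e₂ 1
    have hh : heat n 1 = G * G := rfl
    simp only [Set.Icc.coe_one, contractC_one, contractD_one, hh] at e₁' e₂'
    refine proj_eq_of (M := ((P.1.1.1 * G).submatrix id (midCols k l))⁻¹)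
      (N := (leadInv (P.1.1.1 * G) (P.1.1.2 * G)).submatrix (Fin.castAdd k) (Fin.castAdd k))
      (K := (leadInv (P.1.1.1 * G) (P.1.1.2 * G)).submatrix (Fin.castAdd k) (Fin.natAdd 2)) ?_ ?_
    · rw [e₁', e₂', normC]
      simp only [Matrix.mul_assoc]
    · rw [e₁', e₂', normD]
      simp only [Matrix.add_mul, Matrix.mul_assoc]

/-- The analogue of `exists_paths_pair` for the Grassmannian. -/
theorem exists_paths_mat (k l : ℕ) : ∃ B : NonnegMat k (2 + k + l),
    ∀ C : NonnegMat k (2 + k + l), ∃ γ₁ γ₂ : unitInterval → NonnegMat k (2 + k + l),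
      Continuous γ₁ ∧ Continuous γ₂ ∧ γ₁ 0 = C ∧ γ₂ 0 = B ∧
      Gr.proj (γ₁ 1).1 = Gr.proj (γ₂ 1).1 := by
  have hk : k ≤ 2 + k + l := by omega
  set n := 2 + k + l with hn
  have hq : (0 : ℝ) < 1 / 2 := by norm_num
  have hq1 : (1 / 2 : ℝ) < 1 := by norm_num
  set G := gauss n (1 / 2) with hG
  have hB : MinorsPos (G.submatrix (midCols k l) id) := fun I => gauss_minor_pos hq hq1 _ _
  refine ⟨⟨⟨G.submatrix (midCols k l) id, hB.rank hk⟩, hB.nonneg⟩, fun C => ?_⟩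
  have hC : MinorsPos (C.1.1 * G) := C.2.mul_gauss C.1.2 hq hq1
  have h1 := fun t : unitInterval => C.2.mul_heat hk C.1.2 t.2.1 t.2.2
  have h2 : ∀ t : unitInterval, MinorsPos (contractC (C.1.1 * G) t * G) := fun t =>
    (contractC_nonneg hC t.2.1).mul_gauss (contractC_rank hC t) hq hq1
  refine ⟨fun t => ⟨⟨C.1.1 * heat n t, (h1 t).2⟩, (h1 t).1⟩,
    fun t => ⟨⟨contractC (C.1.1 * G) t * G, (h2 t).rank hk⟩, (h2 t).nonneg⟩, ?_, ?_,
    Subtype.ext (Subtype.ext ?_), Subtype.ext (Subtype.ext ?_), ?_⟩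
  · exact Continuous.subtype_mk (Continuous.subtype_mk (continuous_const.matrix_mul
      ((continuous_heat n).comp continuous_subtype_val)) _) _
  · exact Continuous.subtype_mk (Continuous.subtype_mk
      ((continuous_contractC.comp continuous_subtype_val).matrix_mul continuous_const) _) _
  · simp [heat_zero]
  · simp only [Set.Icc.coe_zero, contractC_zero hC]
    ext i j
    simp [Matrix.mul_apply, Matrix.one_apply]
  · refine Subtype.ext ?_
    have hU : rowSpan (contractC (C.1.1 * G) 1 * G) ≤ rowSpan (C.1.1 * heat n 1) :=
      rowSpan_le_iff.2 ⟨((C.1.1 * G).submatrix id (midCols k l))⁻¹, by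
        have hh : heat n 1 = G * G := rfl
        rw [contractC_one, normC, hh]
        simp only [Matrix.mul_assoc]⟩
    refine (Submodule.eq_of_le_of_finrank_eq hU ?_).symm
    rw [← rank_eq_finrank_rowSpan, ← rank_eq_finrank_rowSpan]
    exact ((h2 1).rank hk).trans (h1 1).2.symm

/-! ### Connectedness -/

theorem isConnected_of_paths {X : Type*} [TopologicalSpace X] {s : Set X} {b : X} (hb : b ∈ s)
    (h : ∀ x ∈ s, ∃ γ₁ γ₂ : unitInterval → X, Continuous γ₁ ∧ Continuous γ₂ ∧ (∀ t, γ₁ t ∈ s) ∧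
      (∀ t, γ₂ t ∈ s) ∧ γ₁ 0 = x ∧ γ₂ 0 = b ∧ γ₁ 1 = γ₂ 1) : IsConnected s := by
  refine IsPathConnected.isConnected ⟨b, hb, fun {x} hx => ?_⟩
  obtain ⟨γ₁, γ₂, h1, h2, m1, m2, e1, e2, e3⟩ := h x hx
  have j1 : JoinedIn s x (γ₁ 1) := ⟨⟨⟨γ₁, h1⟩, e1, rfl⟩, m1⟩
  have j2 : JoinedIn s b (γ₂ 1) := ⟨⟨⟨γ₂, h2⟩, e2, rfl⟩, m2⟩
  exact j2.trans (e3 ▸ j1.symm)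

theorem isConnected_range_nonnegPair {k n : ℕ} (hn : k + 2 ≤ n) {X : Type*} [TopologicalSpace X]
    {f : NonnegPair k n → X} (hf : Continuous f)
    (h : ∀ P Q : NonnegPair k n, Flag.proj P.1 = Flag.proj Q.1 → f P = f Q) :
    IsConnected (Set.range f) := by
  obtain ⟨l, rfl⟩ : ∃ l, n = 2 + k + l := ⟨n - (2 + k), by omega⟩
  obtain ⟨B, -, hB⟩ := exists_paths_pair k l
  refine isConnected_of_paths (Set.mem_range_self B) ?_
  rintro _ ⟨P, rfl⟩
  obtain ⟨γ₁, γ₂, h1, h2, e1, -, -, e2, e3⟩ := hB P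
  exact ⟨f ∘ γ₁, f ∘ γ₂, hf.comp h1, hf.comp h2, fun t => ⟨_, rfl⟩, fun t => ⟨_, rfl⟩,
    congrArg f e1, congrArg f e2, h _ _ e3⟩

theorem isConnected_range_nonnegMat {k n : ℕ} (hn : k + 2 ≤ n) {X : Type*} [TopologicalSpace X]
    {f : NonnegMat k n → X} (hf : Continuous f)
    (h : ∀ C C' : NonnegMat k n, Gr.proj C.1 = Gr.proj C'.1 → f C = f C') :
    IsConnected (Set.range f) := by
  obtain ⟨l, rfl⟩ : ∃ l, n = 2 + k + l := ⟨n - (2 + k), by omega⟩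
  obtain ⟨B, hB⟩ := exists_paths_mat k l
  refine isConnected_of_paths (Set.mem_range_self B) ?_
  rintro _ ⟨P, rfl⟩
  obtain ⟨γ₁, γ₂, h1, h2, e1, e2, e3⟩ := hB P
  exact ⟨f ∘ γ₁, f ∘ γ₂, hf.comp h1, hf.comp h2, fun t => ⟨_, rfl⟩, fun t => ⟨_, rfl⟩,
    congrArg f e1, congrArg f e2, h _ _ e3⟩

theorem continuous_flagProj {k n : ℕ} : Continuous (Flag.proj : FullRankPair k n → Flag k n) :=
  (isQuotientMap_proj k n).continuous

theorem isConnected_posFlag {k n : ℕ} (hn : k + 2 ≤ n) : IsConnected (posFlag k n) := by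
  obtain ⟨l, rfl⟩ : ∃ l, n = 2 + k + l := ⟨n - (2 + k), by omega⟩
  obtain ⟨B, hBp, hB⟩ := exists_paths_pair k l
  refine isConnected_of_paths (b := Flag.proj B.1) ⟨B.1, hBp.1, hBp.2, rfl⟩ ?_
  rintro _ ⟨P, hC, hS, rfl⟩
  obtain ⟨γ₁, γ₂, h1, h2, e1, hp1, hp2, e2, e3⟩ := hB ⟨P, hC.nonneg, hS.nonneg⟩
  have hc : Continuous fun P : NonnegPair k (2 + k + l) => Flag.proj P.1 :=
    continuous_flagProj.comp continuous_subtype_val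
  refine ⟨fun t => Flag.proj (γ₁ t).1, fun t => Flag.proj (γ₂ t).1, hc.comp h1, hc.comp h2,
    fun t => ?_, fun t => ⟨_, (hp2 t).1, (hp2 t).2, rfl⟩, by simp only [e1], by simp only [e2], e3⟩
  by_cases ht : t = 0
  · subst ht
    show Flag.proj (γ₁ 0).1 ∈ _
    rw [e1]
    exact ⟨P, hC, hS, rfl⟩
  · exact ⟨_, (hp1 t ht).1, (hp1 t ht).2, rfl⟩

/-- The nonnegative part is closed, and each of its points is the start of a path that is positive
at all later times. -/
theorem closure_posFlag {k n : ℕ} (hn : k + 2 ≤ n) :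
    closure (posFlag k n) = nonnegFlag k n := by
  refine subset_antisymm (closure_minimal ?_ (isClosed_nonnegFlag k n)) ?_
  · rintro _ ⟨P, hC, hS, rfl⟩
    exact ⟨P, hC.nonneg, hS.nonneg, rfl⟩
  · obtain ⟨l, rfl⟩ : ∃ l, n = 2 + k + l := ⟨n - (2 + k), by omega⟩
    obtain ⟨B, -, hB⟩ := exists_paths_pair k l
    rintro _ ⟨P, hC, hS, rfl⟩
    obtain ⟨γ₁, -, h1, -, e1, hp1, -⟩ := hB ⟨P, hC, hS⟩
    have hc : Continuous fun t => Flag.proj (γ₁ t).1 :=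
      continuous_flagProj.comp (continuous_subtype_val.comp h1)
    have h0 : (0 : unitInterval) ∈ closure {0}ᶜ := by
      rw [(dense_compl_singleton _).closure_eq]
      trivial
    have := map_mem_closure hc h0 (t := posFlag k (2 + k + l))
      fun t ht => ⟨_, (hp1 t ht).1, (hp1 t ht).2, rfl⟩
    rwa [e1] at this

theorem range_proj_nonnegPair (k n : ℕ) :
    Set.range (fun P : NonnegPair k n => Flag.proj P.1) = nonnegFlag k n := by
  ext F
  constructor
  · rintro ⟨P, rfl⟩
    exact ⟨P.1, P.2.1, P.2.2, rfl⟩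
  · rintro ⟨P, hC, hS, rfl⟩
    exact ⟨⟨P, hC, hS⟩, rfl⟩

/-! ### Compactness -/

theorem isCompact_entries_le_one (r n : ℕ) :
    IsCompact {C : Matrix (Fin r) (Fin n) ℝ | ∀ i j, C i j ∈ Set.Icc (-1 : ℝ) 1} := by
  have h1 : IsCompact (Set.univ.pi fun _ : Fin r => Set.univ.pi fun _ : Fin n =>
      Set.Icc (-1 : ℝ) 1) :=
    isCompact_univ_pi fun _ => isCompact_univ_pi fun _ => isCompact_Icc
  have h2 : {C : Matrix (Fin r) (Fin n) ℝ | ∀ i j, C i j ∈ Set.Icc (-1 : ℝ) 1} =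
      (Set.univ.pi fun _ : Fin r => Set.univ.pi fun _ : Fin n => Set.Icc (-1 : ℝ) 1) := by
    refine Set.ext fun C => ⟨fun h i _ j _ => h i j, fun h i j => ?_⟩
    exact h i (Set.mem_univ i) j (Set.mem_univ j)
  exact (congrArg (IsCompact (X := Fin r → Fin n → ℝ)) h2).mpr h1

theorem entries_le_one {r n : ℕ} {C : Matrix (Fin r) (Fin n) ℝ} (h : C * Cᵀ = 1) (i : Fin r)
    (j : Fin n) : C i j ∈ Set.Icc (-1 : ℝ) 1 := by
  have h1 := congrFun (congrFun h i) i
  rw [Matrix.mul_apply, Matrix.one_apply_eq] at h1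
  have h2 : C i j * C i j ≤ 1 := by
    rw [← h1]
    exact Finset.single_le_sum (f := fun j => C i j * Cᵀ j i)
      (fun j _ => mul_self_nonneg (C i j)) (Finset.mem_univ j)
  exact abs_le.1 (abs_le_one_iff_mul_self_le_one.2 h2)

theorem rank_of_orthonormal {r n : ℕ} {C : Matrix (Fin r) (Fin n) ℝ} (h : C * Cᵀ = 1) :
    C.rank = r := by
  rw [← Matrix.rank_self_mul_transpose, h, Matrix.rank_one, Fintype.card_fin]

theorem exists_orthonormal_rows {r n : ℕ} {V : Submodule ℝ (Fin n → ℝ)}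
    (hV : Module.finrank ℝ V = r) :
    ∃ M : Matrix (Fin r) (Fin n) ℝ, rowSpan M = V ∧ M * Mᵀ = 1 := by
  let e := (WithLp.linearEquiv 2 ℝ (Fin n → ℝ)).symm
  let V' : Submodule ℝ (EuclideanSpace ℝ (Fin n)) := V.map e.toLinearMap
  have hV' : Module.finrank ℝ V' = r := by
    rw [← hV]; exact LinearEquiv.finrank_map_eq e V
  let b := (stdOrthonormalBasis ℝ V').reindex (finCongr hV')
  have horth := b.orthonormal
  refine ⟨Matrix.of fun i j => (b i : EuclideanSpace ℝ (Fin n)) j, ?_, ?_⟩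
  · have h1 := congrArg (Submodule.map V'.subtype) b.toBasis.span_eq
    rw [Submodule.map_span, Submodule.map_top, Submodule.range_subtype, ← Set.range_comp] at h1
    have h2 := congrArg (Submodule.map e.symm.toLinearMap) h1
    rw [Submodule.map_span, ← Set.range_comp] at h2
    have h3 : V'.map e.symm.toLinearMap = V := by
      simp only [V', ← Submodule.map_comp]
      simp
    rw [h3] at h2
    rw [rowSpan, ← h2]
    congr 1
  · ext i j
    have := orthonormal_iff_ite.1 horth i j
    rw [Matrix.mul_apply, Matrix.one_apply, ← this, Submodule.coe_inner, PiLp.inner_apply]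
    exact Finset.sum_congr rfl fun l _ => mul_comm _ _

/-- `D` is an orthonormal basis of the orthogonal complement of `U` in `W`. -/
theorem exists_orthonormal_pair {k n : ℕ} (F : Flag k n) :
    ∃ P : FullRankPair k n, P.1.1 * P.1.1ᵀ = 1 ∧ P.1.2 * P.1.2ᵀ = 1 ∧ P.1.1 * P.1.2ᵀ = 0 ∧
      Flag.proj P = F := by
  obtain ⟨C, hC, hCo⟩ := exists_orthonormal_rows F.finrank_U
  let V := F.W ⊓ LinearMap.ker C.mulVecLin
  have hCV : ∀ v ∈ F.U ⊓ V, v = 0 := by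
    rintro v ⟨hv, -, hv0⟩
    obtain ⟨c, rfl⟩ := mem_rowSpan.1 (hC ▸ hv)
    have h1 : C *ᵥ (c ᵥ* C) = 0 := hv0
    rw [← Matrix.mulVec_transpose, Matrix.mulVec_mulVec, hCo, Matrix.one_mulVec] at h1
    rw [h1, Matrix.zero_vecMul]
  have hinf : F.U ⊓ V = ⊥ := eq_bot_iff.2 hCV
  have hsup : F.U ⊔ V = F.W := by
    refine le_antisymm (sup_le F.le inf_le_left) fun w hw => ?_
    -- the orthogonal projection of `w` to the row span of `C`
    have hu : (C *ᵥ w) ᵥ* C ∈ F.U := hC ▸ mem_rowSpan.2 ⟨_, rfl⟩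
    refine Submodule.mem_sup.2 ⟨_, hu, w - (C *ᵥ w) ᵥ* C,
      ⟨F.W.sub_mem hw (F.le hu), ?_⟩, add_sub_cancel _ _⟩
    show C *ᵥ (w - (C *ᵥ w) ᵥ* C) = 0
    rw [Matrix.mulVec_sub, ← Matrix.mulVec_transpose, Matrix.mulVec_mulVec _ C, hCo,
      Matrix.one_mulVec, sub_self]
  have hdim := Submodule.finrank_sup_add_finrank_inf_eq F.U V
  rw [hsup, hinf, finrank_bot, F.finrank_U, F.finrank_W] at hdim
  obtain ⟨D, hD, hDo⟩ := exists_orthonormal_rows (r := 2) (V := V) (by omega)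
  refine ⟨⟨(C, D), rank_of_orthonormal hCo, ?_⟩, hCo, hDo, ?_, ?_⟩
  · rw [rank_eq_finrank_rowSpan, rowSpan_stack, hC, hD, hsup, F.finrank_W]
  · have h1 : ∀ i, C *ᵥ D i = 0 := fun i =>
      (show D i ∈ V from hD ▸ Submodule.subset_span ⟨i, rfl⟩).2
    ext i j
    exact congrFun (h1 j) i
  · ext1
    · exact hC
    · show rowSpan C ⊔ rowSpan D = F.W
      rw [hC, hD, hsup]

theorem stack_rank_of_orthonormal {k n : ℕ} {C : Matrix (Fin k) (Fin n) ℝ}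
    {D : Matrix (Fin 2) (Fin n) ℝ} (hC : C * Cᵀ = 1) (hD : D * Dᵀ = 1) (hCD : C * Dᵀ = 0) :
    C.rank = k ∧ (stack C D).rank = k + 2 := by
  refine stack_rank_of_indep fun a b h => ?_
  have h1 := congrArg (fun v => v ᵥ* Cᵀ) h
  have h2 := congrArg (fun v => v ᵥ* Dᵀ) h
  have hDC : D * Cᵀ = 0 := by
    rw [← Matrix.transpose_transpose D, ← Matrix.transpose_mul, hCD, Matrix.transpose_zero]
  simp only [Matrix.add_vecMul, Matrix.vecMul_vecMul, hC, hD, hCD, hDC, Matrix.vecMul_one,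
    Matrix.vecMul_zero, Matrix.zero_vecMul, add_zero, zero_add] at h1 h2
  exact ⟨h1, h2⟩

theorem isCompact_orthonormal_nonnegMat (k n : ℕ) :
    IsCompact {C : NonnegMat k n | C.1.1 * C.1.1ᵀ = 1} := by
  have h1 : (Subtype.val '' (Subtype.val '' {C : NonnegMat k n | C.1.1 * C.1.1ᵀ = 1}) :
      Set (Matrix (Fin k) (Fin n) ℝ)) = {C | C * Cᵀ = 1 ∧ MinorsNonneg C} := by
    ext C
    constructor
    · rintro ⟨_, ⟨C, hC, rfl⟩, rfl⟩
      exact ⟨hC, C.2⟩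
    · rintro ⟨hC, hn⟩
      exact ⟨_, ⟨⟨⟨C, rank_of_orthonormal hC⟩, hn⟩, hC, rfl⟩, rfl⟩
  have h2 : IsCompact {C : Matrix (Fin k) (Fin n) ℝ | C * Cᵀ = 1 ∧ MinorsNonneg C} := by
    refine (isCompact_entries_le_one k n).of_isClosed_subset ?_ fun C hC => entries_le_one hC.1
    simp only [MinorsNonneg, Set.ofPred_and, Set.ofPred_forall]
    exact (isClosed_eq (continuous_id.matrix_mul continuous_id.matrix_transpose)
      continuous_const).inter
      (isClosed_iInter fun I => isClosed_le continuous_const (continuous_minor continuous_id I))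
  exact Topology.IsInducing.subtypeVal.isCompact_iff.2
    (Topology.IsInducing.subtypeVal.isCompact_iff.2 ((congrArg IsCompact h1).mpr h2))

theorem isCompact_orthonormal_nonnegPair (k n : ℕ) :
    IsCompact {P : NonnegPair k n | P.1.1.1 * P.1.1.1ᵀ = 1 ∧ P.1.1.2 * P.1.1.2ᵀ = 1 ∧
      P.1.1.1 * P.1.1.2ᵀ = 0} := by
  have h1 : (Subtype.val '' (Subtype.val '' {P : NonnegPair k n | P.1.1.1 * P.1.1.1ᵀ = 1 ∧
      P.1.1.2 * P.1.1.2ᵀ = 1 ∧ P.1.1.1 * P.1.1.2ᵀ = 0})) =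
      {P : Matrix (Fin k) (Fin n) ℝ × Matrix (Fin 2) (Fin n) ℝ |
        (P.1 * P.1ᵀ = 1 ∧ P.2 * P.2ᵀ = 1 ∧ P.1 * P.2ᵀ = 0) ∧
        MinorsNonneg P.1 ∧ MinorsNonneg (stack P.1 P.2)} := by
    ext P
    constructor
    · rintro ⟨_, ⟨P, hP, rfl⟩, rfl⟩
      exact ⟨hP, P.2⟩
    · rintro ⟨hP, hn⟩
      exact ⟨_, ⟨⟨⟨P, stack_rank_of_orthonormal hP.1 hP.2.1 hP.2.2⟩, hn⟩, hP, rfl⟩, rfl⟩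
  have h2 : IsCompact {P : Matrix (Fin k) (Fin n) ℝ × Matrix (Fin 2) (Fin n) ℝ |
      (P.1 * P.1ᵀ = 1 ∧ P.2 * P.2ᵀ = 1 ∧ P.1 * P.2ᵀ = 0) ∧
        MinorsNonneg P.1 ∧ MinorsNonneg (stack P.1 P.2)} := by
    refine ((isCompact_entries_le_one k n).prod
      (isCompact_entries_le_one 2 n)).of_isClosed_subset ?_
      fun P hP => ⟨entries_le_one hP.1.1, entries_le_one hP.1.2.1⟩
    simp only [MinorsNonneg, Set.ofPred_and, Set.ofPred_forall]
    have c1 : Continuous fun P : Matrix (Fin k) (Fin n) ℝ × Matrix (Fin 2) (Fin n) ℝ => P.1 :=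
      continuous_fst
    have c2 : Continuous fun P : Matrix (Fin k) (Fin n) ℝ × Matrix (Fin 2) (Fin n) ℝ => P.2 :=
      continuous_snd
    exact ((isClosed_eq (c1.matrix_mul c1.matrix_transpose) continuous_const).inter
      ((isClosed_eq (c2.matrix_mul c2.matrix_transpose) continuous_const).inter
        (isClosed_eq (c1.matrix_mul c2.matrix_transpose) continuous_const))).inter
      ((isClosed_iInter fun I => isClosed_le continuous_const (continuous_minor c1 I)).inter
        (isClosed_iInter fun I => isClosed_le continuous_const
          (continuous_minor (continuous_stack c1 c2) I)))
  exact Topology.IsInducing.subtypeVal.isCompact_iff.2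
    (Topology.IsInducing.subtypeVal.isCompact_iff.2 ((congrArg IsCompact h1).mpr h2))

theorem mul_mul_transpose {r s n : ℕ} (M : Matrix (Fin r) (Fin r) ℝ) (N : Matrix (Fin s) (Fin s) ℝ)
    (A : Matrix (Fin r) (Fin n) ℝ) (B : Matrix (Fin s) (Fin n) ℝ) :
    M * A * (N * B)ᵀ = M * (A * Bᵀ) * Nᵀ := by
  rw [Matrix.transpose_mul]
  simp only [Matrix.mul_assoc]

/-- Representatives with orthonormal rows form a compact set and represent every point. -/
theorem isCompact_range_nonnegMat {k n : ℕ} {X : Type*} [TopologicalSpace X]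
    {f : NonnegMat k n → X} (hf : Continuous f)
    (h : ∀ C C' : NonnegMat k n, Gr.proj C.1 = Gr.proj C'.1 → f C = f C') :
    IsCompact (Set.range f) := by
  convert (isCompact_orthonormal_nonnegMat k n).image hf using 1
  refine subset_antisymm ?_ (Set.image_subset_range _ _)
  rintro _ ⟨C, rfl⟩
  obtain ⟨B, hB, hBo⟩ := exists_orthonormal_rows (Gr.proj C.1).2
  have hBr := rank_of_orthonormal hBo
  have hCB : Gr.proj C.1 = Gr.proj ⟨B, hBr⟩ := Subtype.ext hB.symm
  obtain ⟨M, hM⟩ := rowSpan_le_iff.1 (show rowSpan B ≤ rowSpan C.1.1 from hB.le)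
  have hs : SameSign B := by
    rw [hM]; exact C.2.sameSign.of_minors _ (minor_rowOp M _)
  obtain ⟨S, hS, hSB⟩ := hs.exists_orthogonal
  have hSBo : S * B * (S * B)ᵀ = 1 := by
    rw [mul_mul_transpose, hBo, Matrix.mul_one, hS]
  have hr := rank_of_orthonormal hSBo
  refine ⟨⟨⟨S * B, hr⟩, fun I => by rw [minor_rowOp]; exact hSB I⟩, hSBo, h _ _ ?_⟩
  rw [hCB]
  exact Subtype.ext (Submodule.eq_of_le_of_finrank_eq (rowSpan_le_iff.2 ⟨S, rfl⟩)
    ((Gr.proj ⟨S * B, hr⟩).2.trans (Gr.proj ⟨B, hBr⟩).2.symm))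

/-- Representatives such that the rows of `C` and `D` are orthonormal form a compact set and
represent every nonnegative flag: orthogonal row operations correct the signs of the minors. -/
theorem isCompact_range_nonnegPair {k n : ℕ} {X : Type*} [TopologicalSpace X]
    {f : NonnegPair k n → X} (hf : Continuous f)
    (h : ∀ P Q : NonnegPair k n, Flag.proj P.1 = Flag.proj Q.1 → f P = f Q) :
    IsCompact (Set.range f) := by
  convert (isCompact_orthonormal_nonnegPair k n).image hf using 1
  refine subset_antisymm ?_ (Set.image_subset_range _ _)
  rintro _ ⟨P, rfl⟩
  obtain ⟨Q, h1, h2, h3, hQ⟩ := exists_orthonormal_pair (Flag.proj P.1)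
  have hs := (proj_mem_nonnegFlag Q).1 (hQ ▸ ⟨P.1, P.2.1, P.2.2, rfl⟩)
  obtain ⟨R, M, N, hM, hN, e1, e2, n1, n2, hR⟩ := exists_nonneg_of_sameSign hs.1 hs.2
  refine ⟨⟨R, n1, n2⟩, ⟨?_, ?_, ?_⟩, h _ _ (hR.symm.trans hQ)⟩
  · show R.1.1 * R.1.1ᵀ = 1
    rw [e1, mul_mul_transpose, h1, Matrix.mul_one, hM]
  · show R.1.2 * R.1.2ᵀ = 1
    rw [e2, mul_mul_transpose, h2, Matrix.mul_one, hN]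
  · show R.1.1 * R.1.2ᵀ = 0
    rw [e1, e2, mul_mul_transpose, h3, Matrix.mul_zero, Matrix.zero_mul]

/-! ### Sign changes and total positivity -/

/-- A vector in the row span of an `r × n` matrix of full rank with nonnegative maximal minors does
not alternate in sign along `r + 1` indices. After a small perturbation by the Gaussian kernel the
minors are positive, and the expansion of a vanishing determinant of size `r + 1` along the given
vector would have only negative terms. -/
theorem MinorsNonneg.not_alternating {r n : ℕ} {C : Matrix (Fin r) (Fin n) ℝ}
    (h : MinorsNonneg C) (hr : C.rank = r) (c : Fin r → ℝ) (I : Fin (r + 1) ↪o Fin n) :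
    ¬ ∀ j : Fin (r + 1), (-1) ^ (j : ℕ) * (c ᵥ* C) (I j) < 0 := by
  intro hI
  have hcont : ∀ j : Fin (r + 1), Continuous fun q : ℝ =>
      (-1) ^ (j : ℕ) * (c ᵥ* (C * gauss n q)) (I j) := by
    intro j
    have : Continuous fun q : ℝ => c ᵥ* (C * gauss n q) :=
      continuous_const.matrix_vecMul (continuous_const.matrix_mul (continuous_gauss n))
    exact continuous_const.mul ((continuous_apply (I j)).comp this)
  have hev : ∀ᶠ q : ℝ in nhdsWithin 0 (Set.Ioi 0),
      ∀ j : Fin (r + 1), (-1) ^ (j : ℕ) * (c ᵥ* (C * gauss n q)) (I j) < 0 := by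
    refine nhdsWithin_le_nhds (Filter.eventually_all.2 fun j => ?_)
    refine (hcont j).continuousAt.eventually_lt continuousAt_const ?_
    simpa [gauss_zero] using hI j
  have hev1 : ∀ᶠ q : ℝ in nhdsWithin 0 (Set.Ioi 0), q ∈ Set.Ioo (0 : ℝ) 1 :=
    Ioo_mem_nhdsGT one_pos
  obtain ⟨q, hq, hq0, hq1⟩ := (hev.and hev1).exists
  have hpos := h.mul_gauss hr hq0 hq1
  let A : Matrix (Fin (r + 1)) (Fin (r + 1)) ℝ := Matrix.of
    (Fin.cons (fun j => (c ᵥ* (C * gauss n q)) (I j)) fun i j => (C * gauss n q) i (I j))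
  have hA : A.det = 0 := by
    refine Matrix.exists_vecMul_eq_zero_iff.1 ⟨Fin.cons 1 (-c), fun h0 => ?_, ?_⟩
    · have := congrFun h0 0
      simp at this
    · ext j
      simp [A, Matrix.vecMul, dotProduct, Fin.sum_univ_succ]
  rw [Matrix.det_succ_row_zero] at hA
  refine (Finset.sum_neg (fun j _ => ?_) Finset.univ_nonempty).ne hA
  exact mul_neg_of_neg_of_pos (hq j) (hpos ((Fin.succAboveOrderEmb j).trans I))

/-- The number of sign changes seen before position `i`, starting from the sign `+`. -/
noncomputable def signChanges (w : ℕ → ℝ) : ℕ → ℕ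
  | 0 => 0
  | i + 1 => if (-1) ^ signChanges w i * w i < 0 then signChanges w i + 1 else signChanges w i

theorem signChanges_succ (w : ℕ → ℝ) (i : ℕ) : signChanges w (i + 1) =
    if (-1) ^ signChanges w i * w i < 0 then signChanges w i + 1 else signChanges w i := rfl

theorem signChanges_le_succ (w : ℕ → ℝ) (i : ℕ) : signChanges w i ≤ signChanges w (i + 1) := by
  rw [signChanges_succ]; split_ifs <;> omega

theorem signChanges_succ_le (w : ℕ → ℝ) (i : ℕ) :
    signChanges w (i + 1) ≤ signChanges w i + 1 := by
  rw [signChanges_succ]; split_ifs <;> omega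

theorem signChanges_mono (w : ℕ → ℝ) : Monotone (signChanges w) :=
  monotone_nat_of_le_succ (signChanges_le_succ w)

/-- The current sign `(-1) ^ signChanges w (i + 1)` is a weak sign of the entry `w i`. -/
theorem signChanges_sign (w : ℕ → ℝ) (i : ℕ) : 0 ≤ (-1) ^ signChanges w (i + 1) * w i := by
  rw [signChanges_succ]
  split_ifs with h
  · rw [pow_succ]; linarith
  · exact not_lt.1 h

/-- A discrete intermediate value theorem. -/
theorem exists_eq_of_step {f : ℕ → ℕ} (h0 : f 0 = 0) (hs : ∀ i, f (i + 1) ≤ f i + 1) (N : ℕ) :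
    ∀ c ≤ f N, ∃ i ≤ N, f i = c := by
  induction N with
  | zero => exact fun c hc => ⟨0, le_rfl, by omega⟩
  | succ N ih =>
    intro c hc
    by_cases h : c ≤ f N
    · obtain ⟨i, hi, e⟩ := ih c h
      exact ⟨i, by omega, e⟩
    · exact ⟨N + 1, le_rfl, by have := hs N; omega⟩

theorem exists_signChange (w : ℕ → ℝ) (N : ℕ) :
    ∀ j < signChanges w N, ∃ i < N, signChanges w i = j ∧ (-1) ^ j * w i < 0 := by
  induction N with
  | zero => intro j hj; simp [signChanges] at hj
  | succ N ih =>
    intro j hj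
    by_cases h : j < signChanges w N
    · obtain ⟨i, hi, e⟩ := ih j h
      exact ⟨i, by omega, e⟩
    · rw [signChanges_succ] at hj
      split_ifs at hj with h1
      · obtain rfl : j = signChanges w N := by omega
        exact ⟨N, by omega, rfl, h1⟩
      · exact absurd hj h

/-- The entries of a vector, continued by zero. -/
def extendZero {n : ℕ} (v : Fin n → ℝ) (i : ℕ) : ℝ := if h : i < n then v ⟨i, h⟩ else 0

@[simp]
theorem extendZero_val {n : ℕ} (v : Fin n → ℝ) (i : Fin n) : extendZero v i = v i := by
  simp [extendZero]

theorem MinorsNonneg.signChanges_le {r n : ℕ} {C : Matrix (Fin r) (Fin n) ℝ}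
    (h : MinorsNonneg C) (hr : C.rank = r) (c : Fin r → ℝ) :
    signChanges (extendZero (c ᵥ* C)) n ≤ r := by
  by_contra hlt
  have h1 : ∀ j : Fin (r + 1), ∃ i : Fin n, signChanges (extendZero (c ᵥ* C)) i = j ∧
      (-1) ^ (j : ℕ) * (c ᵥ* C) i < 0 := by
    intro j
    obtain ⟨i, hi, e1, e2⟩ := exists_signChange (extendZero (c ᵥ* C)) n j (by omega)
    exact ⟨⟨i, hi⟩, e1, by rwa [← extendZero_val (c ᵥ* C) ⟨i, hi⟩]⟩
  choose I hI1 hI2 using h1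
  have hmono : StrictMono I := by
    intro j j' hjj
    by_contra hle
    have := signChanges_mono (extendZero (c ᵥ* C)) (show (I j' : ℕ) ≤ I j from not_lt.1 hle)
    rw [hI1, hI1] at this
    exact absurd hjj (not_lt.2 this)
  exact h.not_alternating hr c (OrderEmbedding.ofStrictMono I hmono) hI2

/-- The matrix with rows supported on consecutive blocks of columns, the column `i` lying in the
block `b i` and carrying the weight `u i`. -/
def blockRows {m n : ℕ} (b : Fin n → Fin m) (u : Fin n → ℝ) : Matrix (Fin m) (Fin n) ℝ :=
  Matrix.of fun c i => if b i = c then u i else 0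

/-- A minor of `blockRows b u` is nonzero only if it takes one column from each block. -/
theorem det_blockRows_submatrix {m n : ℕ} {b : Fin n → Fin m} (hb : Monotone b) (u : Fin n → ℝ)
    (I : Fin m ↪o Fin n) : ((blockRows b u).submatrix id I).det =
      if b ∘ I = id then ∏ c, u (I c) else 0 := by
  split_ifs with h
  · have : (blockRows b u).submatrix id I = Matrix.diagonal fun c => u (I c) := by
      ext c j
      have hj : b (I j) = j := congrFun h j
      simp only [blockRows, Matrix.submatrix_apply, Matrix.of_apply, hj, id, Matrix.diagonal_apply]
      rcases eq_or_ne j c with rfl | hjc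
      · simp
      · rw [if_neg hjc, if_neg hjc.symm]
    rw [this, Matrix.det_diagonal]
  · -- a monotone self-map of `Fin m` other than the identity misses a value
    have hns : ¬ Function.Surjective (b ∘ I) := by
      intro hs
      have hm : StrictMono (b ∘ I) := (hb.comp I.monotone).strictMono_of_injective
        (Finite.injective_iff_surjective.2 hs)
      exact h ((hm.range_inj strictMono_id).1 (by rw [hs.range_eq, Set.range_id]))
    simp only [Function.Surjective, not_forall, not_exists] at hns
    obtain ⟨c, hc⟩ := hns
    exact Matrix.det_eq_zero_of_row_eq_zero c fun j => if_neg (hc j)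

theorem det_blockRows_mul_pos {m n : ℕ} {b : Fin n → Fin m} (hb : Monotone b) {u : Fin n → ℝ}
    (hu : ∀ i, 0 ≤ u i) (hex : ∀ c, ∃ i, b i = c ∧ 0 < u i) {Z : Matrix (Fin n) (Fin m) ℝ}
    (hZ : TallMinorsPos Z) : 0 < (blockRows b u * Z).det := by
  rw [det_mul_cauchyBinet]
  simp only [det_blockRows_submatrix hb]
  choose I hI hIu using hex
  have hmono : StrictMono I := by
    intro c c' hc
    by_contra hle
    have := hb (not_lt.1 hle)
    rw [hI, hI] at this
    exact absurd hc (not_lt.2 this)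
  refine Finset.sum_pos' (fun J _ => mul_nonneg ?_ (hZ J).le)
    ⟨OrderEmbedding.ofStrictMono I hmono, Finset.mem_univ _, mul_pos ?_ (hZ _)⟩
  · split_ifs
    · exact Finset.prod_nonneg fun c _ => hu _
    · exact le_rfl
  · rw [if_pos (show b ∘ OrderEmbedding.ofStrictMono I hmono = id from funext hI)]
    exact Finset.prod_pos fun c _ => hIu c

/-- A vector `v` with less than `m` sign changes that is orthogonal to the columns of `Z` vanishes:
it is a combination `s B` of block rows with `det (B Z) > 0`. The blocks of `B` refine the maximal
intervals on which `v` has constant sign, so that there are exactly `m` of them; on a block where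
`v` vanishes the weights are `1`. -/
theorem eq_zero_of_signChanges_lt {m n : ℕ} (hm : m ≤ n) {Z : Matrix (Fin n) (Fin m) ℝ}
    (hZ : TallMinorsPos Z) {v : Fin n → ℝ} (hv0 : 0 ≤ extendZero v 0)
    (hv : signChanges (extendZero v) n < m) (hvZ : v ᵥ* Z = 0) : v = 0 := by
  set w := extendZero v with hw
  set sc := signChanges w with hsc
  have hmono : Monotone sc := signChanges_mono w
  have hstep : ∀ i, sc (i + 1) ≤ sc i + 1 := signChanges_succ_le w
  have hsc1 : sc 1 = 0 := by
    show (if (-1) ^ 0 * w 0 < 0 then 0 + 1 else 0) = 0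
    rw [if_neg]
    simpa using hv0
  -- the second argument of the maximum makes the last block have number `m - 1`
  let f : ℕ → ℕ := fun i => max (sc (i + 1)) (i + m - n)
  have hf0 : f 0 = 0 := by
    simp only [f, zero_add, hsc1]
    omega
  have hfs : ∀ i, f (i + 1) ≤ f i + 1 := by
    intro i
    have := hstep (i + 1)
    simp only [f]
    omega
  have hfm : ∀ i < n, f i < m := by
    intro i hi
    have : sc (i + 1) ≤ sc n := hmono hi
    simp only [f]
    omega
  have hfsc : ∀ i j, i ≤ j → f i = f j → sc (i + 1) = sc (j + 1) := by
    intro i j hij h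
    have : sc (i + 1) ≤ sc (j + 1) := hmono (by omega)
    rcases hij.eq_or_lt with rfl | hij
    · rfl
    · simp only [f] at h
      omega
  let b : Fin n → Fin m := fun i => ⟨f i, hfm i i.2⟩
  have hb : Monotone b := by
    intro i j hij
    have hij' : (i : ℕ) ≤ j := hij
    have : sc (i + 1) ≤ sc (j + 1) := hmono (by omega)
    show f i ≤ f j
    simp only [f]
    omega
  have hbsc : ∀ i j, b i = b j → sc (i + 1) = sc (j + 1) := by
    intro i j h
    have h' : f i = f j := congrArg Fin.val h
    rcases le_total (i : ℕ) j with hij | hij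
    · exact hfsc i j hij h'
    · exact (hfsc j i hij h'.symm).symm
  have hsurj : ∀ c : Fin m, ∃ i, b i = c := by
    intro c
    have hc := c.2
    obtain ⟨i, hi, e⟩ := exists_eq_of_step hf0 hfs (n - 1) c (by simp only [f]; omega)
    exact ⟨⟨i, by omega⟩, Fin.ext e⟩
  classical
  let u : Fin n → ℝ := fun i => if ∃ j, b j = b i ∧ v j ≠ 0 then |v i| else 1
  let s : Fin m → ℝ := fun c =>
    if h : ∃ j, b j = c ∧ v j ≠ 0 then (-1) ^ sc ((h.choose : ℕ) + 1) else 0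
  have hu : ∀ i, 0 ≤ u i := by
    intro i
    simp only [u]
    split_ifs
    · exact abs_nonneg _
    · exact zero_le_one
  have hex : ∀ c, ∃ i, b i = c ∧ 0 < u i := by
    intro c
    by_cases h : ∃ j, b j = c ∧ v j ≠ 0
    · obtain ⟨j, hj, hj0⟩ := h
      refine ⟨j, hj, ?_⟩
      simp only [u]
      rw [if_pos ⟨j, rfl, hj0⟩]
      exact abs_pos.2 hj0
    · obtain ⟨i, rfl⟩ := hsurj c
      refine ⟨i, rfl, ?_⟩
      simp only [u]
      rw [if_neg h]
      exact one_pos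
  have hdet := det_blockRows_mul_pos hb hu hex hZ
  have hsv : s ᵥ* blockRows b u = v := by
    ext i
    have h1 : (s ᵥ* blockRows b u) i = s (b i) * u i := by
      simp [Matrix.vecMul, dotProduct, blockRows]
    rw [h1]
    by_cases h : ∃ j, b j = b i ∧ v j ≠ 0
    · have e := hbsc _ _ h.choose_spec.1
      have hsg : 0 ≤ (-1) ^ sc ((i : ℕ) + 1) * v i := by
        have := signChanges_sign w i
        rwa [hw, extendZero_val] at this
      simp only [s, u]
      rw [dif_pos h, if_pos h, e]
      rcases neg_one_pow_eq_or ℝ (sc ((i : ℕ) + 1)) with h2 | h2 <;> rw [h2] at hsg ⊢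
      · rw [abs_of_nonneg (by linarith), one_mul]
      · rw [abs_of_nonpos (by linarith)]
        ring
    · simp only [s]
      rw [dif_neg h, zero_mul]
      by_contra h0
      exact h ⟨i, rfl, Ne.symm h0⟩
  have hs0 : s = 0 := by
    refine Matrix.eq_zero_of_vecMul_eq_zero hdet.ne' ?_
    rw [← Matrix.vecMul_vecMul, hsv, hvZ]
  rw [← hsv, hs0, Matrix.zero_vecMul]

/-- Right multiplication by `Z` is injective on the row span of a nonnegative matrix. -/
theorem MinorsNonneg.vecMul_eq_zero {r m n : ℕ} (hrm : r < m) (hm : m ≤ n)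
    {C : Matrix (Fin r) (Fin n) ℝ} (h : MinorsNonneg C) (hr : C.rank = r)
    {Z : Matrix (Fin n) (Fin m) ℝ} (hZ : TallMinorsPos Z) {c : Fin r → ℝ}
    (hc : (c ᵥ* C) ᵥ* Z = 0) : c ᵥ* C = 0 := by
  -- the count of sign changes starts from the sign `+`, so the first entry is made nonnegative
  rcases le_total 0 (extendZero (c ᵥ* C) 0) with h0 | h0
  · exact eq_zero_of_signChanges_lt hm hZ h0 ((h.signChanges_le hr c).trans_lt hrm) hc
  · have hneg : (-c) ᵥ* C = -(c ᵥ* C) := Matrix.neg_vecMul _ _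
    have h0' : 0 ≤ extendZero ((-c) ᵥ* C) 0 := by
      rw [hneg]
      unfold extendZero at h0 ⊢
      split_ifs at h0 ⊢
      · simpa using h0
      · exact le_rfl
    have := eq_zero_of_signChanges_lt hm hZ h0' ((h.signChanges_le hr (-c)).trans_lt hrm)
      (by rw [hneg, Matrix.neg_vecMul, hc, neg_zero])
    rwa [hneg, neg_eq_zero] at this

theorem MinorsNonneg.rank_mul {r m n : ℕ} (hrm : r < m) (hm : m ≤ n)
    {C : Matrix (Fin r) (Fin n) ℝ} (h : MinorsNonneg C) (hr : C.rank = r)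
    {Z : Matrix (Fin n) (Fin m) ℝ} (hZ : TallMinorsPos Z) : (C * Z).rank = r := by
  rw [rank_eq_finrank_rowSpan, ← map_rowSpan, ← LinearMap.range_domRestrict,
    LinearMap.finrank_range_of_inj, ← rank_eq_finrank_rowSpan, hr]
  rw [injective_iff_map_eq_zero]
  rintro ⟨v, hv⟩ hv0
  obtain ⟨c, rfl⟩ := mem_rowSpan.1 hv
  exact Subtype.ext (h.vecMul_eq_zero hrm hm hr hZ hv0)

/-! ### The amplituhedra -/

section Amplituhedra

variable {k n : ℕ} (hn : k + 4 ≤ n) {Z : Matrix (Fin n) (Fin (k + 4)) ℝ} (hZ : TallMinorsPos Z)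

/-- The map `C ↦ C Z` on representatives. -/
def mulMat (C : NonnegMat k n) : FullRankMat k (k + 4) :=
  ⟨C.1.1 * Z, C.2.rank_mul (by omega) hn C.1.2 hZ⟩

/-- The map `C ⋮ D ↦ C Z ⋮ D Z` on representatives. -/
def mulPair (P : NonnegPair k n) : FullRankPair k (k + 4) :=
  ⟨(P.1.1.1 * Z, P.1.1.2 * Z), P.2.1.rank_mul (by omega) hn P.1.2.1 hZ, by
    rw [stack_mul, P.2.2.rank_mul (by omega) hn (rank_stack_pair P.1) hZ, add_comm]⟩

theorem toSubmodule_proj_mulMat (C : NonnegMat k n) :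
    (Gr.proj (mulMat hn hZ C)).toSubmodule = (Gr.proj C.1).toSubmodule.map Z.vecMulLinear :=
  (map_proj_tree C.1 Z).symm

theorem toPair_proj_mulPair (P : NonnegPair k n) : (Flag.proj (mulPair hn hZ P)).toPair =
    ((Flag.proj P.1).U.map Z.vecMulLinear, (Flag.proj P.1).W.map Z.vecMulLinear) :=
  Prod.ext (map_proj_loop P.1 Z).1.symm (map_proj_loop P.1 Z).2.symm

theorem toSubmodule_injective (k n : ℕ) : Function.Injective (Gr.toSubmodule : Gr k n → _) :=
  Subtype.val_injective

theorem toPair_injective (k n : ℕ) : Function.Injective (Flag.toPair : Flag k n → _) :=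
  fun _ _ h => Flag.ext (congrArg Prod.fst h) (congrArg Prod.snd h)

theorem treeAmplituhedron_eq : treeAmplituhedron Z =
    Gr.toSubmodule '' Set.range fun C : NonnegMat k n => Gr.proj (mulMat hn hZ C) := by
  ext V
  constructor
  · rintro ⟨_, ⟨C, hC, rfl⟩, rfl⟩
    exact ⟨_, ⟨⟨C, hC⟩, rfl⟩, toSubmodule_proj_mulMat hn hZ ⟨C, hC⟩⟩
  · rintro ⟨_, ⟨C, rfl⟩, rfl⟩
    exact ⟨Gr.proj C.1, ⟨C.1, C.2, rfl⟩, (toSubmodule_proj_mulMat hn hZ C).symm⟩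

theorem loopAmplituhedron_eq : loopAmplituhedron Z =
    Flag.toPair '' Set.range fun P : NonnegPair k n => Flag.proj (mulPair hn hZ P) := by
  ext V
  constructor
  · rintro ⟨_, ⟨P, hC, hS, rfl⟩, rfl⟩
    exact ⟨_, ⟨⟨P, hC, hS⟩, rfl⟩, toPair_proj_mulPair hn hZ ⟨P, hC, hS⟩⟩
  · rintro ⟨_, ⟨P, rfl⟩, rfl⟩
    exact ⟨Flag.proj P.1, ⟨P.1, P.2.1, P.2.2, rfl⟩, (toPair_proj_mulPair hn hZ P).symm⟩

theorem continuous_proj_mulMat :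
    Continuous fun C : NonnegMat k n => Gr.proj (mulMat hn hZ C) := by
  refine Continuous.comp (g := Gr.proj) continuous_coinduced_rng (Continuous.subtype_mk ?_ _)
  exact (continuous_subtype_val.comp continuous_subtype_val).matrix_mul continuous_const

theorem continuous_proj_mulPair :
    Continuous fun P : NonnegPair k n => Flag.proj (mulPair hn hZ P) := by
  refine continuous_flagProj.comp (Continuous.subtype_mk (Continuous.prodMk ?_ ?_) _)
  · exact (continuous_pairC.comp continuous_subtype_val).matrix_mul continuous_const
  · exact ((continuous_snd.comp continuous_subtype_val).comp continuous_subtype_val).matrix_mul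
      continuous_const

theorem proj_mulMat_congr (C C' : NonnegMat k n) (h : Gr.proj C.1 = Gr.proj C'.1) :
    Gr.proj (mulMat hn hZ C) = Gr.proj (mulMat hn hZ C') :=
  toSubmodule_injective _ _ (by rw [toSubmodule_proj_mulMat, toSubmodule_proj_mulMat, h])

theorem proj_mulPair_congr (P Q : NonnegPair k n) (h : Flag.proj P.1 = Flag.proj Q.1) :
    Flag.proj (mulPair hn hZ P) = Flag.proj (mulPair hn hZ Q) :=
  toPair_injective _ _ (by rw [toPair_proj_mulPair, toPair_proj_mulPair, h])

end Amplituhedra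

end Loopy

theorem mainTheorem12 (k n : ℕ) (hn : k + 2 ≤ n) :
    -- the positive part is an open submanifold of full dimension of the flag variety
    (IsManifold (𝓡 (k * (n - k) + 2 * (n - k - 2))) ∞ (Loopy.Flag k n) ∧
      ∃ O : TopologicalSpace.Opens (Loopy.Flag k n),
        (O : Set (Loopy.Flag k n)) = Loopy.posFlag k n ∧
        IsManifold (𝓡 (k * (n - k) + 2 * (n - k - 2))) ∞ O ∧
        Manifold.IsSmoothEmbedding (𝓡 (k * (n - k) + 2 * (n - k - 2)))
          (𝓡 (k * (n - k) + 2 * (n - k - 2))) ∞ (Subtype.val : O → Loopy.Flag k n)) ∧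
    -- it is nonempty and connected
    IsConnected (Loopy.posFlag k n) ∧
    -- its closure is the nonnegative part, which is compact and connected
    closure (Loopy.posFlag k n) = Loopy.nonnegFlag k n ∧
    IsCompact (Loopy.nonnegFlag k n) ∧
    IsConnected (Loopy.nonnegFlag k n) ∧
    -- the tree and one-loop amplituhedra
    (k + 4 ≤ n → ∀ Z : Matrix (Fin n) (Fin (k + 4)) ℝ, Loopy.TallMinorsPos Z →
      (Loopy.treeAmplituhedron Z ⊆
          Set.range (Loopy.Gr.toSubmodule : Loopy.Gr k (k + 4) → _) ∧
        IsCompact ((Loopy.Gr.toSubmodule : Loopy.Gr k (k + 4) → _) ⁻¹'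
          Loopy.treeAmplituhedron Z) ∧
        IsConnected ((Loopy.Gr.toSubmodule : Loopy.Gr k (k + 4) → _) ⁻¹'
          Loopy.treeAmplituhedron Z)) ∧
      (Loopy.loopAmplituhedron Z ⊆
          Set.range (Loopy.Flag.toPair : Loopy.Flag k (k + 4) → _) ∧
        IsCompact ((Loopy.Flag.toPair : Loopy.Flag k (k + 4) → _) ⁻¹'
          Loopy.loopAmplituhedron Z) ∧
        IsConnected ((Loopy.Flag.toPair : Loopy.Flag k (k + 4) → _) ⁻¹'
          Loopy.loopAmplituhedron Z))) := by
  open Loopy in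
  refine ⟨⟨inferInstance, ⟨posFlag k n, isOpen_posFlag k n⟩, rfl, inferInstance,
    Manifold.IsSmoothEmbedding.of_opens _⟩, isConnected_posFlag hn, closure_posFlag hn, ?_,
    closure_posFlag hn ▸ (isConnected_posFlag hn).closure, fun h4 Z hZ => ⟨?_, ?_⟩⟩
  · rw [← range_proj_nonnegPair]
    exact isCompact_range_nonnegPair (continuous_flagProj.comp continuous_subtype_val)
      fun _ _ h => h
  · rw [treeAmplituhedron_eq h4 hZ, Set.preimage_image_eq _ (toSubmodule_injective _ _)]
    exact ⟨Set.image_subset_range _ _,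
      isCompact_range_nonnegMat (continuous_proj_mulMat h4 hZ) (proj_mulMat_congr h4 hZ),
      isConnected_range_nonnegMat hn (continuous_proj_mulMat h4 hZ) (proj_mulMat_congr h4 hZ)⟩
  · rw [loopAmplituhedron_eq h4 hZ, Set.preimage_image_eq _ (toPair_injective _ _)]
    exact ⟨Set.image_subset_range _ _,
      isCompact_range_nonnegPair (continuous_proj_mulPair h4 hZ) (proj_mulPair_congr h4 hZ),
      isConnected_range_nonnegPair hn (continuous_proj_mulPair h4 hZ) (proj_mulPair_congr h4 hZ)⟩
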